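/- Let $K$ be a field. **Definitions.** A *Bergman presentation* $(X,R)$ consists of a finite set $X$ of generators and a finite family $R=\{a_i=b_i\mid i\in I\}$ of relations between nonzero elements $a_i,b_i$ of the free abelian monoid $\langle X\rangle$, together with a partition $I=I_{\mathrm{blue}}\sqcup I_{\mathrm{red}}$ such that: for each $i\in I_{\mathrm{blue}}$ one has $b_i=\sum_{x\in X_i}x$ for a subset $X_i\subseteq X$ with $|X_i|\ge 2$, these $X_i$ being pairwise disjoint; and, with $X_{\mathrm{base}}=X\setminus\bigcup_{i\in I_{\mathrm{blue}}}X_i$, the blue indices can be ordered $i_1,\dots,i_m$ so that $a_{i_k}\in\langle X_{\mathrm{base}}\cup X_{i_1}\cup\dots\cup X_{i_{k-1}}\rangle$ for all $k$. It is *basic* if $X=X_{\mathrm{base}}$. Its *Bergman algebra* $B(X,R)$ is the unital $K$-algebra generated by the entries of square matrices $\epsilon_x$ ($x\in X$) and of matrices $\sigma_i$, $\sigma'_i$ ($i\in I_{\mathrm{red}}$), subject to the relations below. Here $\epsilon_c=\epsilon_{x_1}\oplus\dots\oplus\epsilon_{x_n}$ for $c=x_1+\dots+x_n$; $\epsilon_x$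 is a $1\times1$ matrix if $x\in X_{\mathrm{base}}$, and has the size of $\epsilon_{a_i}$ if $x\in X_i$; $\sigma_i$ has size $|\epsilon_{a_i}|\times|\epsilon_{b_i}|$ and $\sigma'_i$ has size $|\epsilon_{b_i}|\times|\epsilon_{a_i}|$. The relations are: (1) the $\epsilon_x$ with $x\in X_{\mathrm{base}}$ are orthogonal idempotents with sum $1$; (2) for $i\in I_{\mathrm{blue}}$, the $\epsilon_x$ with $x\in X_i$ are orthogonal idempotents with $\epsilon_{a_i}\epsilon_x\epsilon_{a_i}=\epsilon_x$ and sum $\epsilon_{a_i}$; (3) for $i\in I_{\mathrm{red}}$, $\epsilon_{a_i}\sigma_i\epsilon_{b_i}=\sigma_i$, $\epsilon_{b_i}\sigma'_i\epsilon_{a_i}=\sigma'_i$, $\sigma_i\sigma'_i=\epsilon_{a_i}$ and $\sigma'_i\sigma_i=\epsilon_{b_i}$. A *Bergman graph* $H$ is the same datum written as a finite hypergraph: a finite set $H^0$ of vertices, a finite set $H^1$ of hyperedges, maps $s,r$ assigning to each hyperedge a nonempty multiset over $H^0$, and a set of blue hyperedges, such that setting $X=H^0$, $I=H^1$, $a_h=\sum_v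 s(h)(v)v$ and $b_h=\sum_v r(h)(v)v$ gives a Bergman presentation $\beta(H)$; put $B(H)=B(\beta(H))$, and call $H$ basic if $\beta(H)$ is basic. *Insplitting (presentations).* Let $(X,R)$ be basic, and let $x_1\in X$ and $i\in I$ be such that $a_i=x_1$ and $x_1$ is not a summand of $a_j$ for any $j\ne i$. Let $n_j$ be the multiplicity of $x_1$ in $b_j$, suppose that $S=\{(j,k)\mid j\in I,\ 1\le k\le n_j\}$ is nonempty, let $S=S_1\sqcup\dots\sqcup S_t$ be a partition into nonempty subsets, and put $\phi(j,k)=p$ if $(j,k)\in S_p$. For $j\in I$ let $b'_j$ be obtained from $b_j$ by replacing the summand $n_jx_1$ by $x_{\phi(j,1)}+\dots+x_{\phi(j,n_j)}$. The basic Bergman presentation $(X',R')$ with $X'=X\sqcup\{x_2,\dots,x_t\}$ and with the relations $a_j=b'_j$ ($j\in I\setminus\{i\}$) and $x_p=b'_i$ ($1\le p\le t$) is said to be obtained from $(X,R)$ by insplitting. *Insplitting (graphs).* Let $H$ be basic, and let $v_1\in H^0$ and $h_1\in H^1$ be such that $s(h_1)=\{v_1\}$ and $v_1$ is not a source of any $g\ne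 h_1$. Suppose that $S=\{(g,k)\mid g\in H^1,\ 1\le k\le r(g)(v_1)\}$ is nonempty, let $S=S_1\sqcup\dots\sqcup S_t$ be a partition into nonempty subsets, and put $\phi(g,k)=p$ if $(g,k)\in S_p$. The basic Bergman graph $H'$ obtained by adding vertices $v_2,\dots,v_t$ and hyperedges $h_2,\dots,h_t$ and replacing $s,r$ by $s',r'$, where for $g\in H^1\setminus\{h_1\}$, $u\in H^0\setminus\{v_1\}$ and $1\le p,q\le t$ $$s'(g)=s(g),\quad r'(g)(u)=r(g)(u),\quad r'(g)(v_q)=\#\{k\mid \phi(g,k)=q\},$$ $$s'(h_p)=\{v_p\},\quad r'(h_p)(u)=r(h_1)(u),\quad r'(h_p)(v_q)=\#\{k\mid\phi(h_1,k)=q\},$$ is said to be obtained from $H$ by insplitting. **Theorem.** (a) If $(X,R)$ is a basic Bergman presentation and $(X',R')$ can be obtained from $(X,R)$ by insplitting, then $B(X',R')$ and $B(X,R)$ are Morita equivalent; (b) if $H$ is a basic Bergman graph and $H'$ can be obtained from $H$ by insplitting, then $B(H')$ and $B(H)$ are Morita equivalent. In both cases there is a $K$-linear equivalence between the module categories. 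-/

import Mathlib

universe u v w

/-- A Bergman presentation `(X, R)` with `R = {a i = b i | i ∈ I}`. The free abelian monoid on `X`
is `Multiset X`; the family is finite (`X` and `I` are finite) and good (no `a i`, `b i` is zero).
`blue` is the set of blue indices, its complement is the set of red ones. For a blue `i`, the
condition `b i = ∑ x ∈ X_i, x` for a set `X_i` with at least two elements says that the multiset
`b i` has no repetitions and has at least two elements. -/
structure BergmanPresentation (X : Type u) (I : Type v) where
  a : I → Multiset X
  b : I → Multiset X
  finite_generators : Finite X
  finite_relations : Finite I
  a_ne_zero : ∀ i, a i ≠ 0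
  b_ne_zero : ∀ i, b i ≠ 0
  blue : Set I
  blue_nodup : ∀ i ∈ blue, (b i).Nodup
  blue_two_le : ∀ i ∈ blue, 2 ≤ (b i).card
  blue_disjoint : ∀ i ∈ blue, ∀ j ∈ blue, i ≠ j → ∀ x ∈ b i, x ∉ b j
  /-- There is an admissible ordering `e 0, e 1, …` of the blue indices: every summand of
  `a (e k)` is a base generator or lies in some `X_{e p}` with `p < k`. -/
  admissible : ∃ (m : ℕ) (e : Fin m ≃ blue), ∀ k, ∀ y ∈ a (e k),
    (∀ i ∈ blue, y ∉ b i) ∨ ∃ p < k, y ∈ b (e p)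

/-- A Bergman graph: a finite hypergraph with vertex set `V` and hyperedge set `E`, whose sources
and ranges are nonempty multisets (multiplicity functions `V → ℕ`), with its blue hyperedges. -/
structure BergmanGraph (V : Type u) (E : Type v) where
  s : E → V → ℕ
  r : E → V → ℕ
  finite_vertices : Finite V
  finite_edges : Finite E
  s_ne_zero : ∀ h, s h ≠ 0
  r_ne_zero : ∀ h, r h ≠ 0
  blue : Set E
  blue_set : ∀ h ∈ blue, ∀ v, r h v ≤ 1
  blue_two_le : ∀ h ∈ blue, 2 ≤ (Function.support (r h)).ncard
  blue_disjoint : ∀ g ∈ blue, ∀ h ∈ blue, g ≠ h →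
    Disjoint (Function.support (r g)) (Function.support (r h))
  admissible : ∃ (m : ℕ) (e : Fin m ≃ blue), ∀ k, ∀ v ∈ Function.support (s (e k)),
    (∀ h ∈ blue, v ∉ Function.support (r h)) ∨ ∃ p < k, v ∈ Function.support (r (e p))

noncomputable section

open Classical in
/-- The element `∑ v, m v • v` of the free abelian monoid on `V`. -/
def formalSum {V : Type u} [Finite V] (m : V → ℕ) : Multiset V :=
  letI := Fintype.ofFinite V
  ∑ v, m v • ({v} : Multiset V)

open Classical in
theorem count_formalSum {V : Type u} [Finite V] (m : V → ℕ) (v : V) :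
    (formalSum m).count v = m v := by
  simp [formalSum, Multiset.count_sum', Multiset.count_singleton]

theorem mem_formalSum {V : Type u} [Finite V] (m : V → ℕ) (v : V) :
    v ∈ formalSum m ↔ v ∈ Function.support m := by
  classical
  rw [← Multiset.count_pos, count_formalSum, Function.mem_support, Nat.pos_iff_ne_zero]

theorem formalSum_ne_zero {V : Type u} [Finite V] {m : V → ℕ} (hm : m ≠ 0) :
    formalSum m ≠ 0 := by
  obtain ⟨v, hv⟩ := Function.ne_iff.mp hm
  intro h
  have := (mem_formalSum m v).2 hv
  simp [h] at this

theorem formalSum_nodup {V : Type u} [Finite V] {m : V → ℕ} (hm : ∀ v, m v ≤ 1) :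
    (formalSum m).Nodup := by
  classical
  rw [Multiset.nodup_iff_count_le_one]
  intro v
  rw [count_formalSum]
  exact hm v

theorem ncard_support_le_card_formalSum {V : Type u} [Finite V] (m : V → ℕ) :
    (Function.support m).ncard ≤ (formalSum m).card := by
  classical
  have h : Function.support m = ((formalSum m).toFinset : Set V) := by
    ext v
    simp only [Finset.mem_coe, Multiset.mem_toFinset, mem_formalSum]
  rw [h, Set.ncard_coe_finset]
  exact Multiset.toFinset_card_le _

namespace BergmanGraph

variable {V : Type u} {E : Type v}

/-- A vertex that is not a range of a blue hyperedge. -/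
def IsBaseVertex (H : BergmanGraph V E) (v : V) : Prop :=
  ∀ h ∈ H.blue, v ∉ Function.support (H.r h)

/-- A Bergman graph is basic if all its vertices are base vertices. -/
def IsBasic (H : BergmanGraph V E) : Prop :=
  ∀ v, H.IsBaseVertex v

/-- The Bergman presentation that corresponds to a Bergman graph. -/
def toPresentation (H : BergmanGraph V E) : BergmanPresentation V E :=
  haveI := H.finite_vertices
  { a := fun h => formalSum (H.s h)
    b := fun h => formalSum (H.r h)
    finite_generators := H.finite_vertices
    finite_relations := H.finite_edges
    a_ne_zero := fun h => formalSum_ne_zero (H.s_ne_zero h)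
    b_ne_zero := fun h => formalSum_ne_zero (H.r_ne_zero h)
    blue := H.blue
    blue_nodup := fun h hh => formalSum_nodup (H.blue_set h hh)
    blue_two_le := fun h hh => (H.blue_two_le h hh).trans (ncard_support_le_card_formalSum _)
    blue_disjoint := by
      intro g hg h hh hne x hx hx'
      rw [mem_formalSum] at hx hx'
      exact Set.disjoint_left.mp (H.blue_disjoint g hg h hh hne) hx hx'
    admissible := by
      simpa only [mem_formalSum] using H.admissible }

end BergmanGraph

namespace BergmanPresentation

variable {X : Type u} {I : Type v}

/-- A base generator: a generator that lies in no `X_i` with `i` blue. -/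
def IsBase (P : BergmanPresentation X I) (x : X) : Prop :=
  ∀ i ∈ P.blue, x ∉ P.b i

/-- A Bergman presentation is basic if all its generators are base generators. -/
def IsBasic (P : BergmanPresentation X I) : Prop :=
  ∀ x, P.IsBase x

open Classical in
/-- `P.Slot x` is the index set of the rows (and columns) of the square matrix `ε_x`: a single
index if `x` is a base generator; and if `x` is a summand of the right-hand side of a blue
relation `a i = b i`, the index set of the block diagonal matrix `ε_{a i}`, that is, the set of the
triples `(y, k, q)` where `k` numbers the occurrences of `y` in `a i` and `q` is an index of
`ε_y`. -/
inductive Slot (P : BergmanPresentation X I) : X → Type (max u v)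
  | base (x : X) (hx : P.IsBase x) : Slot P x
  | blue (x : X) (i : I) (hi : i ∈ P.blue) (hx : x ∈ P.b i) (y : X)
      (k : Fin ((P.a i).count y)) (q : Slot P y) : Slot P x

open Classical in
/-- The occurrences of generators in an element `c` of the free abelian monoid. -/
abbrev Occ (c : Multiset X) : Type u := Σ y : X, Fin (c.count y)

/-- The index set of the square matrix `ε_c`, for `c` in the free abelian monoid. -/
abbrev Idx (P : BergmanPresentation X I) (c : Multiset X) : Type (max u v) :=
  Σ o : Occ c, P.Slot o.1

/-- The identification of the index set of `ε_{a i}` with that of `ε_x`, for `i` blue and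
`x ∈ X_i`. -/
def blueSlot (P : BergmanPresentation X I) {i : I} (hi : i ∈ P.blue) {x : X} (hx : x ∈ P.b i)
    (q : P.Idx (P.a i)) : P.Slot x :=
  Slot.blue x i hi hx q.1.1 q.1.2 q.2

theorem finite_slot_of_base (P : BergmanPresentation X I) {x : X} (hx : P.IsBase x) :
    Finite (P.Slot x) := by
  suffices h : Subsingleton (P.Slot x) from @Finite.of_subsingleton _ h
  refine ⟨fun p q => ?_⟩
  cases p with
  | base _ _ =>
    cases q with
    | base _ _ => rfl
    | blue _ i hi h _ _ _ => exact absurd h (hx i hi)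
  | blue _ i hi h _ _ _ => exact absurd h (hx i hi)

theorem finite_slot_of_blue (P : BergmanPresentation X I) {i : I} (hi : i ∈ P.blue) {x : X}
    (hx : x ∈ P.b i) (h : ∀ y ∈ P.a i, Finite (P.Slot y)) : Finite (P.Slot x) := by
  classical
  have := P.finite_generators
  have : ∀ o : Occ (P.a i), Finite (P.Slot o.1) := fun o =>
    h o.1 (Multiset.count_pos.mp (lt_of_le_of_lt (Nat.zero_le _) o.2.2))
  refine Finite.of_surjective (P.blueSlot hi hx) ?_
  intro p
  cases p with
  | base _ hb => exact absurd hx (hb i hi)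
  | blue _ j hj hxj y k q =>
    have hij : j = i := by
      by_contra hne
      exact P.blue_disjoint j hj i hi hne x hxj hx
    subst hij
    exact ⟨⟨⟨y, k⟩, q⟩, rfl⟩

instance finite_slot (P : BergmanPresentation X I) (x : X) : Finite (P.Slot x) := by
  obtain ⟨m, e, he⟩ := P.admissible
  have key : ∀ n : ℕ, ∀ k : Fin m, k.1 = n → ∀ y ∈ P.b (e k), Finite (P.Slot y) := by
    intro n
    induction n using Nat.strong_induction_on with
    | _ n ih =>
      intro k hk y hy
      refine P.finite_slot_of_blue (e k).2 hy ?_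
      intro z hz
      rcases he k z hz with hz | ⟨p, hp, hz⟩
      · exact P.finite_slot_of_base hz
      · exact ih p.1 (hk ▸ hp) p rfl z hz
  by_cases hx : P.IsBase x
  · exact P.finite_slot_of_base hx
  · simp only [IsBase, not_forall, not_not] at hx
    obtain ⟨i, hi, hxi⟩ := hx
    refine key _ (e.symm ⟨i, hi⟩) rfl x ?_
    simpa using hxi

instance fintypeGenerators (P : BergmanPresentation X I) : Fintype {x : X // P.IsBase x} :=
  haveI := P.finite_generators
  Fintype.ofFinite _

instance fintypeSummands (c : Multiset X) : Fintype {x : X // x ∈ c} := by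
  classical
  exact Fintype.ofFinset c.toFinset (fun _ => Multiset.mem_toFinset)

instance fintypeIdx (P : BergmanPresentation X I) (c : Multiset X) : Fintype (P.Idx c) :=
  haveI := P.finite_generators
  Fintype.ofFinite _

/-- The symbols that generate the Bergman algebra: the entries of the matrices `ε_x` for all
generators `x`, and of the matrices `σ_i` and `σ'_i` for all red `i`. -/
inductive Sym (P : BergmanPresentation X I) : Type (max u v)
  | eps (x : X) (p q : P.Slot x) : Sym P
  | sigma (i : I) (hi : i ∉ P.blue) (p : P.Idx (P.a i)) (q : P.Idx (P.b i)) : Sym P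
  | sigma' (i : I) (hi : i ∉ P.blue) (q : P.Idx (P.b i)) (p : P.Idx (P.a i)) : Sym P

section Matrices

variable (K : Type w) [Field K] (P : BergmanPresentation X I)

/-- The matrix `ε_x` of symbols. -/
def epsGen (x : X) : Matrix (P.Slot x) (P.Slot x) (FreeAlgebra K P.Sym) :=
  Matrix.of fun p q => FreeAlgebra.ι K (Sym.eps x p q)

open Classical in
/-- The matrix `ε_c = ε_{x_1} ⊕ ⋯ ⊕ ε_{x_n}` for `c = x_1 + ⋯ + x_n`. -/
def epsSum (c : Multiset X) : Matrix (P.Idx c) (P.Idx c) (FreeAlgebra K P.Sym) :=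
  Matrix.blockDiagonal' fun o : Occ c => epsGen K P o.1

/-- For a base generator `x`, the unique entry of the one by one matrix `ε_x`. -/
def epsBase (x : X) (hx : P.IsBase x) : FreeAlgebra K P.Sym :=
  epsGen K P x (Slot.base x hx) (Slot.base x hx)

/-- For `i` blue and `x ∈ X_i`, the matrix `ε_x` as a matrix of the size of `ε_{a i}`. -/
def epsBlue {i : I} (hi : i ∈ P.blue) {x : X} (hx : x ∈ P.b i) :
    Matrix (P.Idx (P.a i)) (P.Idx (P.a i)) (FreeAlgebra K P.Sym) :=
  (epsGen K P x).submatrix (P.blueSlot hi hx) (P.blueSlot hi hx)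

/-- The matrix `σ_i` of symbols. -/
def sigmaMat (i : I) (hi : i ∉ P.blue) :
    Matrix (P.Idx (P.a i)) (P.Idx (P.b i)) (FreeAlgebra K P.Sym) :=
  Matrix.of fun p q => FreeAlgebra.ι K (Sym.sigma i hi p q)

/-- The matrix `σ'_i` of symbols. -/
def sigmaMat' (i : I) (hi : i ∉ P.blue) :
    Matrix (P.Idx (P.b i)) (P.Idx (P.a i)) (FreeAlgebra K P.Sym) :=
  Matrix.of fun q p => FreeAlgebra.ι K (Sym.sigma' i hi q p)

/-- The defining relations of the Bergman algebra.
* `base_*`: the `ε_x`, `x` a base generator, are orthogonal idempotents with sum `1`, so that they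
  generate `K^{X_base}`.
* `blue_*`: for `i` blue, the `ε_x`, `x ∈ X_i`, are orthogonal idempotent matrices in the corner
  of `ε_{a i}` with sum `ε_{a i}`; this adjoins a universal decomposition
  `[P_{a i}] = ∑ x ∈ X_i, [P_x]`.
* `red_*`: for `i` red, `σ_i` and `σ'_i` are mutually inverse isomorphisms between the projective
  modules given by `ε_{a i}` and `ε_{b i}`; this adjoins a universal isomorphism
  `[P_{a i}] = [P_{b i}]`. -/
inductive Rel : FreeAlgebra K P.Sym → FreeAlgebra K P.Sym → Prop
  | base_idem (x : X) (hx : P.IsBase x) :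
      Rel (epsBase K P x hx * epsBase K P x hx) (epsBase K P x hx)
  | base_orth (x y : X) (hx : P.IsBase x) (hy : P.IsBase y) (hxy : x ≠ y) :
      Rel (epsBase K P x hx * epsBase K P y hy) 0
  | base_sum : Rel (∑ x : {x : X // P.IsBase x}, epsBase K P x.1 x.2) 1
  | blue_corner (i : I) (hi : i ∈ P.blue) (x : X) (hx : x ∈ P.b i) (p q : P.Idx (P.a i)) :
      Rel ((epsSum K P (P.a i) * epsBlue K P hi hx * epsSum K P (P.a i)) p q)
        (epsBlue K P hi hx p q)
  | blue_idem (i : I) (hi : i ∈ P.blue) (x : X) (hx : x ∈ P.b i) (p q : P.Idx (P.a i)) :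
      Rel ((epsBlue K P hi hx * epsBlue K P hi hx) p q) (epsBlue K P hi hx p q)
  | blue_orth (i : I) (hi : i ∈ P.blue) (x y : X) (hx : x ∈ P.b i) (hy : y ∈ P.b i)
      (hxy : x ≠ y) (p q : P.Idx (P.a i)) :
      Rel ((epsBlue K P hi hx * epsBlue K P hi hy) p q) 0
  | blue_sum (i : I) (hi : i ∈ P.blue) (p q : P.Idx (P.a i)) :
      Rel ((∑ x : {x : X // x ∈ P.b i}, epsBlue K P hi x.2) p q) (epsSum K P (P.a i) p q)
  | red_sigma (i : I) (hi : i ∉ P.blue) (p : P.Idx (P.a i)) (q : P.Idx (P.b i)) :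
      Rel ((epsSum K P (P.a i) * sigmaMat K P i hi * epsSum K P (P.b i)) p q)
        (sigmaMat K P i hi p q)
  | red_sigma' (i : I) (hi : i ∉ P.blue) (q : P.Idx (P.b i)) (p : P.Idx (P.a i)) :
      Rel ((epsSum K P (P.b i) * sigmaMat' K P i hi * epsSum K P (P.a i)) q p)
        (sigmaMat' K P i hi q p)
  | red_left (i : I) (hi : i ∉ P.blue) (p q : P.Idx (P.a i)) :
      Rel ((sigmaMat K P i hi * sigmaMat' K P i hi) p q) (epsSum K P (P.a i) p q)
  | red_right (i : I) (hi : i ∉ P.blue) (p q : P.Idx (P.b i)) :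
      Rel ((sigmaMat' K P i hi * sigmaMat K P i hi) p q) (epsSum K P (P.b i) p q)

/-- The Bergman algebra `B(X, R)` over the field `K`. -/
abbrev BergmanAlgebra : Type (max u v w) := RingQuot (Rel K P)

end Matrices

open Classical in
/-- `splitSum x₁ new gen φ c` is obtained from `c` by keeping (through `old`) all summands other
than `x₁` and replacing the `k`-th occurrence of `x₁` by the generator `gen (φ k)`. -/
def splitSum {X' : Type u} {n : ℕ} (x₁ : X) (old : X → X') (gen : Fin n → X')
    (c : Multiset X) (φ : Fin (c.count x₁) → Fin n) : Multiset X' :=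
  (c.filter (fun x => x ≠ x₁)).map old +
    ∑ k : Fin (c.count x₁), ({gen (φ k)} : Multiset X')

open Classical in
/-- `P'` can be obtained from the basic presentation `P` by insplitting. With `t = s + 1 ≥ 1`, a
partition of the set `S` of the occurrences of `x₁` on right-hand sides into nonempty sets
`S_1, …, S_t` is a surjection `φ` from `S` onto `Fin (s + 1)`; in particular `S` is nonempty.
Through `eX`, the generators of `P'` are those of `P` and `s` new ones; through `eI`, the relations
of `P'` are indexed by the indices of `P` and `s` new ones. The copies `x_1, …, x_t` are `gen 0`
(the generator `x₁` itself), `gen 1`, …, `gen s`, and the relation `x_p = b'_i` has the index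
`rel (p - 1)`, where `rel 0` is the old index `i`. -/
def IsInsplitting {X' : Type u} {I' : Type v} (P : BergmanPresentation X I)
    (P' : BergmanPresentation X' I') : Prop :=
  P.IsBasic ∧ P'.IsBasic ∧
  ∃ (x₁ : X) (i : I) (s : ℕ) (φ : (Σ j : I, Fin ((P.b j).count x₁)) → Fin (s + 1))
    (eX : X ⊕ Fin s ≃ X') (eI : I ⊕ Fin s ≃ I'),
    P.a i = {x₁} ∧ (∀ j, j ≠ i → x₁ ∉ P.a j) ∧ Function.Surjective φ ∧
    let old : X → X' := fun x => eX (Sum.inl x)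
    let gen : Fin (s + 1) → X' := Fin.cons (old x₁) fun q => eX (Sum.inr q)
    let rel : Fin (s + 1) → I' := Fin.cons (eI (Sum.inl i)) fun q => eI (Sum.inr q)
    let b' : I → Multiset X' := fun j => splitSum x₁ old gen (P.b j) fun k => φ ⟨j, k⟩
    (∀ j, j ≠ i → P'.a (eI (Sum.inl j)) = (P.a j).map old ∧ P'.b (eI (Sum.inl j)) = b' j) ∧
    ∀ p, P'.a (rel p) = {gen p} ∧ P'.b (rel p) = b' i

end BergmanPresentation

namespace BergmanGraph

variable {V : Type u} {E : Type v}

/-- The Bergman algebra `B(H)` of a Bergman graph over the field `K`. -/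
abbrev BergmanAlgebra (K : Type w) [Field K] (H : BergmanGraph V E) : Type (max u v w) :=
  BergmanPresentation.BergmanAlgebra K H.toPresentation

open Classical in
/-- `H'` can be obtained from the basic Bergman graph `H` by insplitting. With `t = n + 1 ≥ 1`, a
partition of the set `S` of the pairs `(g, k)`, `1 ≤ k ≤ r(g)(v₁)`, into nonempty sets
`S_1, …, S_t` is a surjection `φ` from `S` onto `Fin (n + 1)`. The vertices (hyperedges) of `H'`
are, through `eV` (`eE`), those of `H` and `n` new ones; `vtx 0` is `v₁` and `edge 0` is `h₁`. -/
def IsInsplitting {V' : Type u} {E' : Type v} (H : BergmanGraph V E)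
    (H' : BergmanGraph V' E') : Prop :=
  H.IsBasic ∧ H'.IsBasic ∧
  ∃ (v₁ : V) (h₁ : E) (n : ℕ) (φ : (Σ g : E, Fin (H.r g v₁)) → Fin (n + 1))
    (eV : V ⊕ Fin n ≃ V') (eE : E ⊕ Fin n ≃ E'),
    H.s h₁ = Pi.single v₁ 1 ∧ (∀ g, g ≠ h₁ → H.s g v₁ = 0) ∧ Function.Surjective φ ∧
    let old : V → V' := fun u => eV (Sum.inl u)
    let vtx : Fin (n + 1) → V' := Fin.cons (old v₁) fun q => eV (Sum.inr q)
    let edge : Fin (n + 1) → E' := Fin.cons (eE (Sum.inl h₁)) fun q => eE (Sum.inr q)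
    (∀ g, g ≠ h₁ →
      (∀ u, H'.s (eE (Sum.inl g)) (old u) = H.s g u) ∧
      (∀ q, H'.s (eE (Sum.inl g)) (vtx q) = 0) ∧
      (∀ u, u ≠ v₁ → H'.r (eE (Sum.inl g)) (old u) = H.r g u) ∧
      ∀ q, H'.r (eE (Sum.inl g)) (vtx q) = Nat.card {k : Fin (H.r g v₁) // φ ⟨g, k⟩ = q}) ∧
    ∀ p,
      H'.s (edge p) = Pi.single (vtx p) 1 ∧
      (∀ u, u ≠ v₁ → H'.r (edge p) (old u) = H.r h₁ u) ∧
      ∀ q, H'.r (edge p) (vtx q) = Nat.card {k : Fin (H.r h₁ v₁) // φ ⟨h₁, k⟩ = q}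

end BergmanGraph

end

-- In a basic presentation every relation is red, so the Bergman algebra is universal for orthogonal
-- idempotents `e x` with sum 1 together with mutually inverse matrices between the two sides of
-- each relation. After insplitting, all copies `x_1, …, x_t` have the same right-hand side `b'_i`,
-- so their idempotents are equivalent: going from `x_p` to `b'_i` and back to `x_1` gives the
-- explicit elements `toCopy` and `ofCopy`. Hence the old idempotents add up to a full idempotent of
-- the new algebra `B`, and its corner is the old algebra `A`.
--
-- No normal forms are needed for this. Universal properties provide two homomorphisms that need not
-- preserve 1: `Φ : A → B` keeps the old idempotents and reroutes right-hand sides from the copies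
-- back to `x_1` (`Split.restrict`), while `Ψ` from `B` to matrices over `A` puts the copies at
-- distinct diagonal positions (`Rep.split`). On generators, hence everywhere, `Ψ ∘ Φ` and the
-- entrywise `Φ ∘ Ψ` are of the form `x ↦ (v p * x * u q)` with `∑ p, u p * v p = 1`. The criterion
-- `IsMoritaEquivalent.of_nonUnitalAlgHom` turns such data into the equivalence `N ↦ Φ 1 • N`;
-- `RelFamily.isMoritaEquivalent_split` applies it.
--
-- `Model.rep_isUniversal` supplies the universal property of the Bergman algebra. What remains is
-- combinatorial: insplitting is a relabelling of the occurrences on right-hand sides, and the graph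
-- version translates to presentations by counting multiplicities.

universe y z

/-! ### Morita equivalence from a pair of non-unital homomorphisms -/

section Corner

open CategoryTheory Matrix.Module

variable {K : Type*} [Field K] {A R : Type z} [Ring A] [Ring R] [Algebra K A] [Algebra K R]

/-- For a homomorphism `Θ : A → R` that need not preserve `1`, the part `Θ 1 • N` of an `R`-module
`N`. It is a (unital) `A`-module. -/
def NonUnitalAlgHom.corner (Θ : A →ₙₐ[K] R) (N : Type*) [AddCommGroup N] [Module R N] :
    AddSubgroup N where
  carrier := {n | Θ 1 • n = n}
  add_mem' {a b} ha hb := by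
    simp only [Set.mem_ofPred_eq] at *
    rw [smul_add, ha, hb]
  zero_mem' := smul_zero _
  neg_mem' {a} ha := by
    simp only [Set.mem_ofPred_eq] at *
    rw [smul_neg, ha]

namespace NonUnitalAlgHom

variable (Θ : A →ₙₐ[K] R) {N : Type*} [AddCommGroup N] [Module R N]

theorem mem_corner {n : N} : n ∈ Θ.corner N ↔ Θ 1 • n = n := Iff.rfl

theorem smul_mem_corner (a : A) (n : N) : Θ a • n ∈ Θ.corner N := by
  rw [mem_corner, ← mul_smul, ← map_mul, one_mul]

noncomputable instance cornerModule : Module A (Θ.corner N) where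
  smul a n := ⟨Θ a • n.1, Θ.smul_mem_corner a n.1⟩
  one_smul n := Subtype.ext n.2
  mul_smul a b n := Subtype.ext (by
    change Θ (a * b) • n.1 = Θ a • Θ b • n.1
    rw [map_mul, mul_smul])
  smul_zero a := Subtype.ext (smul_zero (Θ a))
  smul_add a m n := Subtype.ext (smul_add (Θ a) m.1 n.1)
  add_smul a b n := Subtype.ext (by
    change Θ (a + b) • n.1 = Θ a • n.1 + Θ b • n.1
    rw [map_add, add_smul])
  zero_smul n := Subtype.ext (by
    change Θ 0 • n.1 = 0
    rw [map_zero, zero_smul])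

/-- The restriction of an `R`-linear map to the corners. -/
noncomputable def cornerMap {N' : Type*} [AddCommGroup N'] [Module R N'] (g : N →ₗ[R] N') :
    Θ.corner N →ₗ[A] Θ.corner N' where
  toFun n := ⟨g n.1, by rw [mem_corner, ← map_smul, (mem_corner Θ).1 n.2]⟩
  map_add' m n := Subtype.ext (map_add g m.1 n.1)
  map_smul' a n := Subtype.ext (map_smul g (Θ a) n.1)

/-- The functor `N ↦ Θ 1 • N` from `R`-modules to `A`-modules. -/
noncomputable def cornerFunctor : ModuleCat.{z} R ⥤ ModuleCat.{z} A where
  obj N := ModuleCat.of A (Θ.corner N)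
  map g := ModuleCat.ofHom (Θ.cornerMap g.hom)

-- The element `Θ (k • 1) = k • Θ 1` acts on the corner as the scalar `k`, even if `Θ` does not
-- preserve 1.
open scoped ModuleCat.Algebra in
theorem cornerFunctor_linear : Θ.cornerFunctor.Linear K where
  map_smul {N N'} g k := by
    ext n
    apply Subtype.ext
    change algebraMap K R k • g.hom n.1 = Θ (algebraMap K A k) • g.hom n.1
    rw [Algebra.algebraMap_eq_smul_one, Algebra.algebraMap_eq_smul_one, map_smul, smul_assoc,
      smul_assoc, one_smul]
    have h : Θ 1 • g.hom n.1 = g.hom n.1 := by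
      rw [← map_smul g.hom]
      exact congrArg g.hom n.2
    exact congrArg (k • ·) h.symm

end NonUnitalAlgHom

variable {A B : Type (max y z)} [Ring A] [Algebra K A] [Ring B] [Algebra K B] {ι : Type y}
  [Fintype ι] [DecidableEq ι]

/-- The idempotent `Φ 1` is full, since each `v p` lies in `Φ 1 * B` and `∑ p, u p * v p = 1`; its
corner plays the role of `A`. Instead of identifying that corner, the proof checks that `N ↦ Φ 1 •
N` is fully faithful and essentially surjective. -/
theorem IsMoritaEquivalent.of_nonUnitalAlgHom (Φ : A →ₙₐ[K] B) (Ψ : B →ₙₐ[K] Matrix ι ι A)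
    (u v : ι → B) (r c : ι → A) (huv : ∑ p, u p * v p = 1) (hcr : ∑ p, c p * r p = 1)
    (hr : ∀ p, v p * Φ 1 = Φ (r p))
    (hΦ : ∀ b p q, Φ (Ψ b p q) = v p * b * u q) (hΨ : ∀ a p q, Ψ (Φ a) p q = r p * a * c q) :
    IsMoritaEquivalent K B A := by
  -- Inserting `∑ q, u q * v q = 1` after `v p` exhibits it as a combination of values of `Φ`, which
  -- `Φ 1` fixes on the left.
  have hv : ∀ p, Φ 1 * v p = v p := fun p => by
    have h : v p = ∑ q, Φ (Ψ 1 p q) * v q := by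
      simp_rw [hΦ, mul_assoc, ← Finset.mul_sum, huv, mul_one]
    rw [h, Finset.mul_sum]
    exact Finset.sum_congr rfl fun q _ => by rw [← mul_assoc, ← map_mul, one_mul]
  have hN : ∀ (N : Type (max y z)) [AddCommGroup N] [Module B N] (n : N),
      n = ∑ p, u p • v p • n := fun N _ _ n => by
    simp_rw [← mul_smul, ← Finset.sum_smul, huv, one_smul]
  let part (N : Type (max y z)) [AddCommGroup N] [Module B N] (p : ι) : N →+ Φ.corner N :=
    { toFun := fun n => ⟨v p • n, by rw [Φ.mem_corner, ← mul_smul, hv]⟩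
      map_zero' := Subtype.ext (smul_zero _)
      map_add' := fun m n => Subtype.ext (smul_add _ _ _) }
  have part_smul : ∀ (N : Type (max y z)) [AddCommGroup N] [Module B N] (p : ι) (b : B) (n : N),
      part N p (b • n) = ∑ q, Ψ b p q • part N q n := fun N _ _ p b n => by
    apply Subtype.ext
    rw [AddSubgroup.val_finsetSum]
    change v p • b • n = ∑ q, Φ (Ψ b p q) • v q • n
    conv_lhs => rw [hN N n]
    simp_rw [hΦ, Finset.smul_sum, mul_smul]
  -- Every `n` is rebuilt from its parts `v p • n`, which lie in the corner, so a `B`-linear map is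
  -- determined there.
  have faithful : Φ.cornerFunctor.Faithful := ⟨fun {N N'} g g' h => by
    ext n
    have h' : ∀ p, g.hom (v p • n) = g'.hom (v p • n) := fun p =>
      congrArg Subtype.val (LinearMap.congr_fun (congrArg ModuleCat.Hom.hom h) (part N p n))
    change g.hom n = g'.hom n
    rw [hN N n, map_sum, map_sum]
    exact Finset.sum_congr rfl fun p _ => by
      rw [map_smul g.hom (u p), map_smul g'.hom (u p), h']⟩
  have full : Φ.cornerFunctor.Full := ⟨fun {N N'} h => by
    let h₀ : Φ.corner N →ₗ[A] Φ.corner N' := h.hom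
    -- This extension of `h` is forced. It is `B`-linear because `b` acts on the parts through the
    -- entries of `Ψ b`, which are elements of `A`; it restricts to `h` because `v p` acts on the
    -- corner as `r p`.
    let g : N →ₗ[B] N' :=
      { toFun := fun n => ∑ p, u p • (h₀ (part N p n)).1
        map_add' := fun m n => by
          rw [← Finset.sum_add_distrib]
          exact Finset.sum_congr rfl fun p _ => by
            rw [map_add, map_add, AddSubgroup.coe_add, smul_add]
        map_smul' := fun b n => by
          have h1 : ∀ p, (h₀ (part N p (b • n))).1 = ∑ q, v p • b • u q • (h₀ (part N q n)).1 := by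
            intro p
            rw [part_smul, map_sum, AddSubgroup.val_finsetSum]
            refine Finset.sum_congr rfl fun q _ => ?_
            rw [map_smul]
            change Φ (Ψ b p q) • (h₀ (part N q n)).1 = _
            rw [hΦ, mul_smul, mul_smul]
          simp_rw [h1, ← Finset.smul_sum]
          exact (hN N' _).symm }
    refine ⟨ModuleCat.ofHom g, ?_⟩
    ext n
    apply Subtype.ext
    change ∑ p, u p • (h₀ (part N p n.1)).1 = (h₀ n).1
    have h2 : ∀ p, part N p n.1 = r p • (n : Φ.corner N) := fun p => by
      apply Subtype.ext
      change v p • n.1 = Φ (r p) • n.1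
      rw [← hr, mul_smul]
      exact congrArg (v p • ·) n.2.symm
    have h3 : ∀ p, (h₀ (part N p n.1)).1 = v p • (h₀ n).1 := fun p => by
      rw [h2]
      refine (congrArg Subtype.val (map_smul h₀ (r p) n)).trans ?_
      change Φ (r p) • (h₀ n).1 = _
      rw [← hr, mul_smul]
      exact congrArg (v p • ·) (h₀ n).2
    simp_rw [h3]
    exact (hN N' _).symm⟩
  have hr_sum : ∀ p, ∑ q, Ψ (Φ 1) p q * r q = r p := fun p => by
    simp_rw [hΨ, mul_one, mul_assoc, ← Finset.mul_sum, hcr, mul_one]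
  -- The matrix `Ψ (Φ 1)` fixes the column `r` and is itself fixed by left multiplication with `Ψ
  -- 1`.
  have hrΨ : ∀ p, ∑ q, Ψ 1 p q * r q = r p := fun p => by
    calc ∑ q, Ψ 1 p q * r q = ∑ q, ∑ t, Ψ 1 p q * (Ψ (Φ 1) q t * r t) := by
          simp_rw [← Finset.mul_sum, hr_sum]
      _ = ∑ t, (Ψ 1 * Ψ (Φ 1)) p t * r t := by
          rw [Finset.sum_comm]
          simp_rw [← mul_assoc, ← Finset.sum_mul, Matrix.mul_apply]
      _ = r p := by rw [← map_mul, one_mul, hr_sum]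
  have essSurj : Φ.cornerFunctor.EssSurj := ⟨fun M => by
    -- On this module `Φ 1` acts as the matrix `(r p * c q)`, which factors through `M` by `n ↦ ∑ p,
    -- c p • n p` and `m ↦ (r p • m)`. As `∑ p, c p * r p = 1`, its image is a copy of `M`.
    let N : Type (max y z) := Ψ.corner (ι → M)
    let f : M →ₗ[A] Φ.corner N :=
      { toFun := fun m => ⟨⟨fun p => r p • m, funext fun p => by
            change ∑ q, Ψ 1 p q • r q • m = r p • m
            simp_rw [← mul_smul, ← Finset.sum_smul, hrΨ]⟩, Subtype.ext <| funext fun p => by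
            change ∑ q, Ψ (Φ 1) p q • r q • m = r p • m
            simp_rw [hΨ, mul_one, mul_smul, ← Finset.smul_sum, ← mul_smul, ← Finset.sum_smul, hcr,
              one_smul]⟩
        map_add' := fun m m' => Subtype.ext <| Subtype.ext <| funext fun p => smul_add _ _ _
        map_smul' := fun a m => Subtype.ext <| Subtype.ext <| funext fun p => by
          change r p • a • m = ∑ q, Ψ (Φ a) p q • r q • m
          simp_rw [hΨ, mul_smul, ← Finset.smul_sum, ← mul_smul, ← Finset.sum_smul, hcr,
            one_smul] }
    let g : Φ.corner N → M := fun n => ∑ p, c p • n.1.1 p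
    let e : M ≃ₗ[A] Φ.corner N :=
      { f with
        invFun := g
        left_inv := fun m => by
          change ∑ p, c p • r p • m = m
          simp_rw [← mul_smul, ← Finset.sum_smul, hcr, one_smul]
        right_inv := fun n => Subtype.ext <| Subtype.ext <| funext fun p => by
          have h : ∑ q, Ψ (Φ 1) p q • n.1.1 q = n.1.1 p :=
            congrFun (congrArg Subtype.val (Φ.mem_corner.1 n.2)) p
          change r p • ∑ q, c q • n.1.1 q = n.1.1 p
          rw [← h]
          simp_rw [hΨ, mul_one, mul_smul, Finset.smul_sum] }
    exact ⟨ModuleCat.of B N, ⟨e.symm.toModuleIso⟩⟩⟩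
  have : Φ.cornerFunctor.IsEquivalence := {}
  exact ⟨⟨⟨Φ.cornerFunctor.asEquivalence, Φ.cornerFunctor_linear⟩⟩⟩

end Corner

/-! ### Representations of families of relations and universal algebras -/

/-- A family of relations `∑ a, α j a = ∑ b, β j b` on generators in `Y`, whose sides are indexed
families of generators. -/
structure RelFamily (Y : Type u) (J : Type v) where
  A : J → Type y
  B : J → Type y
  [fintypeA : ∀ j, Fintype (A j)]
  [fintypeB : ∀ j, Fintype (B j)]
  α : ∀ j, A j → Y
  β : ∀ j, B j → Y

namespace RelFamily

attribute [instance] fintypeA fintypeB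

variable {Y : Type u} {J : Type v}

open Classical in
/-- Orthogonal idempotents `e y` in a ring, with mutually inverse matrices `s j` and `t j` between
`⨁ a, e (α j a)` and `⨁ b, e (β j b)`. -/
structure Rep (D : RelFamily.{u, v, y} Y J) (R : Type z) [Ring R] where
  e : Y → R
  s : ∀ j, D.A j → D.B j → R
  t : ∀ j, D.B j → D.A j → R
  idem : ∀ y, e y * e y = e y
  orth : ∀ y y', y ≠ y' → e y * e y' = 0
  e_s : ∀ j a b, e (D.α j a) * s j a b = s j a b
  s_e : ∀ j a b, s j a b * e (D.β j b) = s j a b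
  e_t : ∀ j b a, e (D.β j b) * t j b a = t j b a
  t_e : ∀ j b a, t j b a * e (D.α j a) = t j b a
  s_t : ∀ j a a', ∑ b, s j a b * t j b a' = if a = a' then e (D.α j a) else 0
  t_s : ∀ j b b', ∑ a, t j b a * s j a b' = if b = b' then e (D.β j b) else 0

namespace Rep

variable {D : RelFamily.{u, v, y} Y J} {R : Type z} [Ring R]

/-- A map is compatible with two representations if it sends the one to the other. -/
structure Compat {R' : Type*} [Ring R'] (ρ : Rep D R) (ρ' : Rep D R') (φ : R → R') : Prop where
  e : ∀ y, φ (ρ.e y) = ρ'.e y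
  s : ∀ j a b, φ (ρ.s j a b) = ρ'.s j a b
  t : ∀ j b a, φ (ρ.t j b a) = ρ'.t j b a

/-- `ρ` is universal among the representations in `K`-algebras (with respect to homomorphisms that
need not preserve `1`). -/
structure IsUniversal (K : Type w) [Field K] [Algebra K R] [Fintype Y] (ρ : Rep D R) : Prop where
  sum_e : ∑ y, ρ.e y = 1
  lift : ∀ (R' : Type z) [Ring R'] [Algebra K R'] (ρ' : Rep D R'),
    ∃ φ : R →ₙₐ[K] R', ρ.Compat ρ' φ
  ext : ∀ (R' : Type z) [Ring R'] [Algebra K R'] (φ ψ : R →ₙₐ[K] R'),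
    (∀ y, φ (ρ.e y) = ψ (ρ.e y)) → (∀ j a b, φ (ρ.s j a b) = ψ (ρ.s j a b)) →
    (∀ j b a, φ (ρ.t j b a) = ψ (ρ.t j b a)) → φ = ψ

variable [Fintype Y] (ρ : Rep D R)

theorem sum_e_mul (y : Y) : (∑ y', ρ.e y') * ρ.e y = ρ.e y := by
  rw [Finset.sum_mul, Finset.sum_eq_single y (fun y' _ h => ρ.orth y' y h) (by simp), ρ.idem]

theorem mul_sum_e (y : Y) : ρ.e y * ∑ y', ρ.e y' = ρ.e y := by
  rw [Finset.mul_sum, Finset.sum_eq_single y (fun y' _ h => ρ.orth y y' h.symm) (by simp), ρ.idem]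

theorem isIdempotentElem_sum_e : IsIdempotentElem (∑ y, ρ.e y) := by
  rw [IsIdempotentElem, Finset.sum_mul]
  exact Finset.sum_congr rfl fun y _ => ρ.mul_sum_e y

/-- The corner ring in which a representation is unital. -/
abbrev Corner : Type z := ρ.isIdempotentElem_sum_e.Corner

theorem mem_corner_of {x : R} {y y' : Y} (h : ρ.e y * x = x) (h' : x * ρ.e y' = x) :
    x ∈ Subsemigroup.corner (∑ y, ρ.e y) := by
  rw [Subsemigroup.mem_corner_iff ρ.isIdempotentElem_sum_e]
  constructor
  · rw [← h, ← mul_assoc, sum_e_mul]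
  · rw [← h', mul_assoc, mul_sum_e]

/-- The inclusion of the corner ring. -/
def cornerVal : ρ.Corner →ₙ+* R where
  toFun := Subtype.val
  map_mul' _ _ := rfl
  map_zero' := rfl
  map_add' _ _ := rfl

theorem cornerVal_injective : Function.Injective ρ.cornerVal := Subtype.val_injective

variable (K : Type w) [Field K] [Algebra K R]

instance cornerSMul : SMul K ρ.Corner where
  smul k x := ⟨k • x.1, by
    have hx := (Subsemigroup.mem_corner_iff ρ.isIdempotentElem_sum_e).1 x.2
    rw [Subsemigroup.mem_corner_iff ρ.isIdempotentElem_sum_e, mul_smul_comm, smul_mul_assoc,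
      hx.1, hx.2]
    exact ⟨rfl, rfl⟩⟩

theorem cornerVal_smul (k : K) (x : ρ.Corner) : ρ.cornerVal (k • x) = k • ρ.cornerVal x := rfl

instance cornerModule : Module K ρ.Corner :=
  Function.Injective.module K (ρ.cornerVal : ρ.Corner →+ R) ρ.cornerVal_injective
    (ρ.cornerVal_smul K)

instance cornerAlgebra : Algebra K ρ.Corner :=
  Algebra.ofModule
    (fun k x y => ρ.cornerVal_injective (smul_mul_assoc k x.1 y.1))
    (fun k x y => ρ.cornerVal_injective (mul_smul_comm k x.1 y.1))

/-- The inclusion of the corner ring as a homomorphism of algebras. -/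
def cornerHom : ρ.Corner →ₙₐ[K] R :=
  { ρ.cornerVal with map_smul' := ρ.cornerVal_smul K }

/-- An element of the corner ring. -/
def cornerMk {x : R} {y y' : Y} (h : ρ.e y * x = x) (h' : x * ρ.e y' = x) : ρ.Corner :=
  ⟨x, ρ.mem_corner_of h h'⟩

@[simp]
theorem cornerVal_mk {x : R} {y y' : Y} (h : ρ.e y * x = x) (h' : x * ρ.e y' = x) :
    ρ.cornerVal (ρ.cornerMk h h') = x := rfl

/-- A representation, viewed in its corner ring. -/
def toCorner : Rep D ρ.Corner where
  e y := ρ.cornerMk (ρ.idem y) (ρ.idem y)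
  s j a b := ρ.cornerMk (ρ.e_s j a b) (ρ.s_e j a b)
  t j b a := ρ.cornerMk (ρ.e_t j b a) (ρ.t_e j b a)
  idem y := ρ.cornerVal_injective (by simp [ρ.idem])
  orth y y' h := ρ.cornerVal_injective (by simp [ρ.orth y y' h])
  e_s j a b := ρ.cornerVal_injective (by simp [ρ.e_s])
  s_e j a b := ρ.cornerVal_injective (by simp [ρ.s_e])
  e_t j b a := ρ.cornerVal_injective (by simp [ρ.e_t])
  t_e j b a := ρ.cornerVal_injective (by simp [ρ.t_e])
  s_t j a a' := ρ.cornerVal_injective (by simp [ρ.s_t, apply_ite ρ.cornerVal])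
  t_s j b b' := ρ.cornerVal_injective (by simp [ρ.t_s, apply_ite ρ.cornerVal])

theorem sum_toCorner_e : ∑ y, ρ.toCorner.e y = 1 :=
  ρ.cornerVal_injective (by rw [map_sum]; rfl)

/-- Any representation becomes unital in the corner ring of `∑ y, ρ'.e y`. The unital homomorphism
into that ring, followed by its inclusion, is the required non-unital one. -/
theorem IsUniversal.of_unital {ρ : Rep D R} (hρ : ∑ y, ρ.e y = 1)
    (lift : ∀ (R' : Type z) [Ring R'] [Algebra K R'] (ρ' : Rep D R'), ∑ y, ρ'.e y = 1 →
      ∃ φ : R →ₐ[K] R', ρ.Compat ρ' φ)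
    (ext : ∀ (R' : Type z) [Ring R'] [Algebra K R'] (φ ψ : R →ₙₐ[K] R'),
      (∀ y, φ (ρ.e y) = ψ (ρ.e y)) → (∀ j a b, φ (ρ.s j a b) = ψ (ρ.s j a b)) →
      (∀ j b a, φ (ρ.t j b a) = ψ (ρ.t j b a)) → φ = ψ) :
    ρ.IsUniversal K where
  sum_e := hρ
  lift R' _ _ ρ' := by
    obtain ⟨φ, hφ⟩ := lift ρ'.Corner ρ'.toCorner ρ'.sum_toCorner_e
    exact ⟨(ρ'.cornerHom K).comp (φ : R →ₙₐ[K] ρ'.Corner),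
      fun y => congrArg ρ'.cornerVal (hφ.e y), fun j a b => congrArg ρ'.cornerVal (hφ.s j a b),
      fun j b a => congrArg ρ'.cornerVal (hφ.t j b a)⟩
  ext := ext

end Rep

end RelFamily

/-! ### Bergman algebras of basic presentations as universal algebras -/

namespace BergmanPresentation

variable {X : Type u} {I : Type v} {P : BergmanPresentation X I}

/-- The right-hand side of a blue relation is nonzero, and its summands are not base generators. -/
theorem IsBasic.notMem_blue (hP : P.IsBasic) (i : I) : i ∉ P.blue := fun hi => by
  obtain ⟨x, hx⟩ := Multiset.exists_mem_of_ne_zero (P.b_ne_zero i)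
  exact hP x i hi hx

theorem IsBasic.slot_eq (hP : P.IsBasic) {x : X} (p : P.Slot x) : p = Slot.base x (hP x) := by
  cases p with
  | base _ _ => rfl
  | blue _ i hi hx y k q => exact absurd hi (hP.notMem_blue i)

open Classical in
theorem IsBasic.epsSum_eq (hP : P.IsBasic) (K : Type w) [Field K] (c : Multiset X) (p q : P.Idx c) :
    epsSum K P c p q = if p = q then epsBase K P p.1.1 (hP _) else 0 := by
  obtain ⟨o, p⟩ := p
  obtain ⟨o', q⟩ := q
  rw [hP.slot_eq p, hP.slot_eq q]
  by_cases h : o = o'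
  · subst h
    simp [epsSum, Matrix.blockDiagonal'_apply, epsBase]
  · simp [epsSum, Matrix.blockDiagonal'_apply, h]

/-- An identification of the relations of a basic presentation with the relations of an indexed
family. -/
structure Model (P : BergmanPresentation X I) {Y : Type*} {J : Type*} (D : RelFamily Y J) where
  basic : P.IsBasic
  eX : Y ≃ X
  eI : J ≃ I
  idxA : ∀ {i j}, eI j = i → P.Idx (P.a i) ≃ D.A j
  idxB : ∀ {i j}, eI j = i → P.Idx (P.b i) ≃ D.B j
  idxA_spec : ∀ {i j} (h : eI j = i) q, eX (D.α j (idxA h q)) = q.1.1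
  idxB_spec : ∀ {i j} (h : eI j = i) q, eX (D.β j (idxB h q)) = q.1.1

namespace Model

variable {Y : Type*} {J : Type*} {D : RelFamily Y J} (M : P.Model D) (K : Type w) [Field K]

/-- The generator of the Bergman algebra that corresponds to a symbol. -/
abbrev gen (x : P.Sym) : P.BergmanAlgebra K := RingQuot.mkAlgHom K (Rel K P) (FreeAlgebra.ι K x)

/-- The idempotent of the Bergman algebra that corresponds to a base generator. -/
abbrev genEps (x : X) (hx : P.IsBase x) : P.BergmanAlgebra K :=
  gen K (Sym.eps x (Slot.base x hx) (Slot.base x hx))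

theorem epsSum_mul_mul_epsSum {c d : Multiset X} (hP : P.IsBasic)
    (m : Matrix (P.Idx c) (P.Idx d) (FreeAlgebra K P.Sym)) (p : P.Idx c) (q : P.Idx d) :
    (epsSum K P c * m * epsSum K P d) p q =
      epsBase K P p.1.1 (hP _) * m p q * epsBase K P q.1.1 (hP _) := by
  classical
  simp [Matrix.mul_apply, hP.epsSum_eq]

theorem genEps_idem (x : X) (hx : P.IsBase x) :
    genEps K x hx * genEps K x hx = genEps K x hx := by
  have h := RingQuot.mkAlgHom_rel K (Rel.base_idem (K := K) (P := P) x hx)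
  rwa [map_mul] at h

theorem genEps_sigma (hP : P.IsBasic) (i : I) (hi : i ∉ P.blue) (p : P.Idx (P.a i))
    (q : P.Idx (P.b i)) :
    genEps K p.1.1 (hP _) * gen K (Sym.sigma i hi p q) * genEps K q.1.1 (hP _) =
      gen K (Sym.sigma i hi p q) := by
  have h := RingQuot.mkAlgHom_rel K (Rel.red_sigma (K := K) (P := P) i hi p q)
  rwa [epsSum_mul_mul_epsSum K hP, map_mul, map_mul] at h

theorem genEps_sigma' (hP : P.IsBasic) (i : I) (hi : i ∉ P.blue) (p : P.Idx (P.a i))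
    (q : P.Idx (P.b i)) :
    genEps K q.1.1 (hP _) * gen K (Sym.sigma' i hi q p) * genEps K p.1.1 (hP _) =
      gen K (Sym.sigma' i hi q p) := by
  have h := RingQuot.mkAlgHom_rel K (Rel.red_sigma' (K := K) (P := P) i hi q p)
  rwa [epsSum_mul_mul_epsSum K hP, map_mul, map_mul] at h

open Classical in
theorem sum_sigma_mul_sigma' (hP : P.IsBasic) (i : I) (hi : i ∉ P.blue) (p p' : P.Idx (P.a i)) :
    ∑ q, gen K (Sym.sigma i hi p q) * gen K (Sym.sigma' i hi q p') =
      if p = p' then genEps K p.1.1 (hP _) else 0 := by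
  have h := RingQuot.mkAlgHom_rel K (Rel.red_left (K := K) (P := P) i hi p p')
  rw [hP.epsSum_eq, Matrix.mul_apply, map_sum] at h
  simp_rw [map_mul] at h
  refine h.trans ?_
  split_ifs
  · rfl
  · exact map_zero _

open Classical in
theorem sum_sigma'_mul_sigma (hP : P.IsBasic) (i : I) (hi : i ∉ P.blue) (q q' : P.Idx (P.b i)) :
    ∑ p, gen K (Sym.sigma' i hi q p) * gen K (Sym.sigma i hi p q') =
      if q = q' then genEps K q.1.1 (hP _) else 0 := by
  have h := RingQuot.mkAlgHom_rel K (Rel.red_right (K := K) (P := P) i hi q q')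
  rw [hP.epsSum_eq, Matrix.mul_apply, map_sum] at h
  simp_rw [map_mul] at h
  refine h.trans ?_
  split_ifs
  · rfl
  · exact map_zero _

theorem genEps_congr (hP : P.IsBasic) {x y : X} (h : x = y) :
    genEps K x (hP _) = genEps K y (hP _) := by
  subst h
  rfl

theorem genEps_α {i : I} {j : J} (h : M.eI j = i) (a : D.A j) :
    genEps K (M.eX (D.α j a)) (M.basic _) =
      genEps K ((M.idxA h).symm a).1.1 (M.basic _) :=
  genEps_congr K M.basic (by rw [← M.idxA_spec h, Equiv.apply_symm_apply])

theorem genEps_β {i : I} {j : J} (h : M.eI j = i) (b : D.B j) :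
    genEps K (M.eX (D.β j b)) (M.basic _) =
      genEps K ((M.idxB h).symm b).1.1 (M.basic _) :=
  genEps_congr K M.basic (by rw [← M.idxB_spec h, Equiv.apply_symm_apply])

/-- The tautological representation in the Bergman algebra. -/
def rep : D.Rep (P.BergmanAlgebra K) where
  e y := genEps K (M.eX y) (M.basic _)
  s j a b := gen K (Sym.sigma (M.eI j) (M.basic.notMem_blue _) ((M.idxA rfl).symm a)
    ((M.idxB rfl).symm b))
  t j b a := gen K (Sym.sigma' (M.eI j) (M.basic.notMem_blue _) ((M.idxB rfl).symm b)
    ((M.idxA rfl).symm a))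
  idem y := genEps_idem K _ _
  orth y y' h := by
    have h := RingQuot.mkAlgHom_rel K (Rel.base_orth (K := K) (P := P) _ _ (M.basic (M.eX y))
      (M.basic (M.eX y')) (M.eX.injective.ne h))
    rwa [map_mul, map_zero] at h
  e_s j a b := by
    rw [M.genEps_α K rfl, ← genEps_sigma K M.basic, ← mul_assoc, ← mul_assoc, genEps_idem]
  s_e j a b := by
    rw [M.genEps_β K rfl, ← genEps_sigma K M.basic, mul_assoc, genEps_idem]
  e_t j b a := by
    rw [M.genEps_β K rfl, ← genEps_sigma' K M.basic, ← mul_assoc, ← mul_assoc, genEps_idem]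
  t_e j b a := by
    rw [M.genEps_α K rfl, ← genEps_sigma' K M.basic, mul_assoc, genEps_idem]
  s_t j a a' := by
    classical
    rw [Equiv.sum_comp (M.idxB rfl).symm fun q => gen K (Sym.sigma (M.eI j) _ _ q) *
      gen K (Sym.sigma' (M.eI j) _ q _), sum_sigma_mul_sigma' K M.basic, M.genEps_α K rfl]
    simp only [EmbeddingLike.apply_eq_iff_eq]
  t_s j b b' := by
    classical
    rw [Equiv.sum_comp (M.idxA rfl).symm fun p => gen K (Sym.sigma' (M.eI j) _ _ p) *
      gen K (Sym.sigma (M.eI j) _ p _), sum_sigma'_mul_sigma K M.basic, M.genEps_β K rfl]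
    simp only [EmbeddingLike.apply_eq_iff_eq]

/-- The values on symbols of the homomorphism given by a representation. -/
def symVal {R : Type*} [Ring R] (ρ : D.Rep R) : P.Sym → R
  | Sym.eps x _ _ => ρ.e (M.eX.symm x)
  | Sym.sigma i _ p q => ρ.s (M.eI.symm i) (M.idxA (M.eI.apply_symm_apply i) p)
      (M.idxB (M.eI.apply_symm_apply i) q)
  | Sym.sigma' i _ q p => ρ.t (M.eI.symm i) (M.idxB (M.eI.apply_symm_apply i) q)
      (M.idxA (M.eI.apply_symm_apply i) p)

/-- Allowing any `j` with `M.eI j = i`, and not only `M.eI.symm i`, avoids transporting indices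
between the types attached to `M.eI.symm (M.eI j)` and to `j`. -/
theorem symVal_sigma {R : Type*} [Ring R] (ρ : D.Rep R) {i : I} {j : J} (h : M.eI j = i)
    (hi : i ∉ P.blue) (p : P.Idx (P.a i)) (q : P.Idx (P.b i)) :
    M.symVal ρ (Sym.sigma i hi p q) = ρ.s j (M.idxA h p) (M.idxB h q) := by
  obtain rfl : j = M.eI.symm i := by rw [← h, Equiv.symm_apply_apply]
  rfl

theorem symVal_sigma' {R : Type*} [Ring R] (ρ : D.Rep R) {i : I} {j : J} (h : M.eI j = i)
    (hi : i ∉ P.blue) (p : P.Idx (P.a i)) (q : P.Idx (P.b i)) :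
    M.symVal ρ (Sym.sigma' i hi q p) = ρ.t j (M.idxB h q) (M.idxA h p) := by
  obtain rfl : j = M.eI.symm i := by rw [← h, Equiv.symm_apply_apply]
  rfl

theorem lift_rel {R : Type*} [Ring R] [Algebra K R] [Fintype Y] (ρ : D.Rep R)
    (hρ : ∑ y, ρ.e y = 1) ⦃x y : FreeAlgebra K P.Sym⦄ (h : Rel K P x y) :
    FreeAlgebra.lift K (M.symVal ρ) x = FreeAlgebra.lift K (M.symVal ρ) y := by
  classical
  have he : ∀ x hx, FreeAlgebra.lift K (M.symVal ρ) (epsBase K P x hx) = ρ.e (M.eX.symm x) :=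
    fun x hx => FreeAlgebra.lift_ι_apply _ _
  have hα : ∀ (i : I) (p : P.Idx (P.a i)), M.eX.symm p.1.1 =
      D.α (M.eI.symm i) (M.idxA (M.eI.apply_symm_apply i) p) := fun i p => by
    rw [← M.idxA_spec (M.eI.apply_symm_apply i), Equiv.symm_apply_apply]
  have hβ : ∀ (i : I) (p : P.Idx (P.b i)), M.eX.symm p.1.1 =
      D.β (M.eI.symm i) (M.idxB (M.eI.apply_symm_apply i) p) := fun i p => by
    rw [← M.idxB_spec (M.eI.apply_symm_apply i), Equiv.symm_apply_apply]
  have hs : ∀ i hi p q, FreeAlgebra.lift K (M.symVal ρ) (sigmaMat K P i hi p q) =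
      ρ.s (M.eI.symm i) (M.idxA (M.eI.apply_symm_apply i) p)
        (M.idxB (M.eI.apply_symm_apply i) q) := fun i hi p q => FreeAlgebra.lift_ι_apply _ _
  have ht : ∀ i hi q p, FreeAlgebra.lift K (M.symVal ρ) (sigmaMat' K P i hi q p) =
      ρ.t (M.eI.symm i) (M.idxB (M.eI.apply_symm_apply i) q)
        (M.idxA (M.eI.apply_symm_apply i) p) := fun i hi q p => FreeAlgebra.lift_ι_apply _ _
  cases h with
  | base_idem x hx => rw [map_mul, he, ρ.idem]
  | base_orth x y hx hy hxy =>
    rw [map_mul, he, he, map_zero, ρ.orth _ _ (M.eX.symm.injective.ne hxy)]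
  | base_sum =>
    simp_rw [map_sum, map_one, he, ← hρ]
    exact Fintype.sum_equiv ((Equiv.subtypeUnivEquiv M.basic).trans M.eX.symm) _ _ fun _ => rfl
  | red_sigma i hi p q =>
    rw [epsSum_mul_mul_epsSum K M.basic, map_mul, map_mul, he, he, hs, hα, hβ, ρ.e_s, ρ.s_e]
  | red_sigma' i hi q p =>
    rw [epsSum_mul_mul_epsSum K M.basic, map_mul, map_mul, he, he, ht, hα, hβ, ρ.e_t, ρ.t_e]
  | red_left i hi p p' =>
    simp_rw [Matrix.mul_apply, map_sum, map_mul, hs, ht, M.basic.epsSum_eq]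
    rw [Equiv.sum_comp (M.idxB (M.eI.apply_symm_apply i)) fun b =>
      ρ.s (M.eI.symm i) _ b * ρ.t (M.eI.symm i) b _, ρ.s_t, apply_ite (FreeAlgebra.lift K _), he,
      hα, map_zero]
    simp only [EmbeddingLike.apply_eq_iff_eq]
  | red_right i hi q q' =>
    simp_rw [Matrix.mul_apply, map_sum, map_mul, hs, ht, M.basic.epsSum_eq]
    rw [Equiv.sum_comp (M.idxA (M.eI.apply_symm_apply i)) fun a =>
      ρ.t (M.eI.symm i) _ a * ρ.s (M.eI.symm i) a _, ρ.t_s, apply_ite (FreeAlgebra.lift K _), he,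
      hβ, map_zero]
    simp only [EmbeddingLike.apply_eq_iff_eq]
  -- The remaining constructors are the blue relations.
  | _ i hi => exact absurd hi (M.basic.notMem_blue i)

theorem sum_rep_e [Fintype Y] : ∑ y, (M.rep K).e y = 1 := by
  have h := RingQuot.mkAlgHom_rel K (Rel.base_sum (K := K) (P := P))
  rw [map_sum, map_one] at h
  rw [← h]
  exact (Fintype.sum_equiv ((Equiv.subtypeUnivEquiv M.basic).trans M.eX.symm) _ _ fun x =>
    genEps_congr K M.basic (M.eX.apply_symm_apply x.1).symm).symm

/-- This reduces the comparison of two homomorphisms to their values on the tautological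
representation. -/
theorem gen_mem_rep (x : P.Sym) : (∃ y, gen K x = (M.rep K).e y) ∨
    (∃ j a b, gen K x = (M.rep K).s j a b) ∨ ∃ j b a, gen K x = (M.rep K).t j b a := by
  cases x with
  | eps x p q =>
    refine Or.inl ⟨M.eX.symm x, ?_⟩
    rw [M.basic.slot_eq p, M.basic.slot_eq q]
    exact genEps_congr K M.basic (M.eX.apply_symm_apply x).symm
  | sigma i hi p q =>
    obtain ⟨j, rfl⟩ := M.eI.surjective i
    refine Or.inr <| Or.inl ⟨j, M.idxA rfl p, M.idxB rfl q, ?_⟩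
    simp only [rep, Equiv.symm_apply_apply]
  | sigma' i hi q p =>
    obtain ⟨j, rfl⟩ := M.eI.surjective i
    refine Or.inr <| Or.inr ⟨j, M.idxB rfl q, M.idxA rfl p, ?_⟩
    simp only [rep, Equiv.symm_apply_apply]

theorem rep_isUniversal [Fintype Y] : (M.rep K).IsUniversal K := by
  refine .of_unital K (M.sum_rep_e K) (fun R _ _ ρ hρ => ?_) fun R _ _ φ ψ he hs ht => ?_
  · refine ⟨RingQuot.liftAlgHom K ⟨FreeAlgebra.lift K (M.symVal ρ), M.lift_rel K ρ hρ⟩,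
      fun y => ?_, fun j a b => ?_, fun j b a => ?_⟩
    · change RingQuot.liftAlgHom K _ (gen K _) = _
      rw [RingQuot.liftAlgHom_mkAlgHom_apply, FreeAlgebra.lift_ι_apply]
      exact congrArg ρ.e (M.eX.symm_apply_apply y)
    · change RingQuot.liftAlgHom K _ (gen K _) = _
      rw [RingQuot.liftAlgHom_mkAlgHom_apply, FreeAlgebra.lift_ι_apply, M.symVal_sigma ρ rfl,
        Equiv.apply_symm_apply, Equiv.apply_symm_apply]
    · change RingQuot.liftAlgHom K _ (gen K _) = _
      rw [RingQuot.liftAlgHom_mkAlgHom_apply, FreeAlgebra.lift_ι_apply, M.symVal_sigma' ρ rfl,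
        Equiv.apply_symm_apply, Equiv.apply_symm_apply]
  -- Neither map has to preserve 1, so agreement on scalars has to come from `1 = ∑ y, e y`.
  · have h1 : φ 1 = ψ 1 := by
      rw [← M.sum_rep_e K, map_sum, map_sum]
      exact Finset.sum_congr rfl fun y _ => he y
    ext x
    obtain ⟨x, rfl⟩ := RingQuot.mkAlgHom_surjective K (Rel K P) x
    induction x using FreeAlgebra.induction with
    | grade0 k =>
      rw [Algebra.algebraMap_eq_smul_one, map_smul, map_one, map_smul, map_smul, h1]
    | grade1 x =>
      rcases M.gen_mem_rep K x with ⟨y, h⟩ | ⟨j, a, b, h⟩ | ⟨j, b, a, h⟩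
      · exact (congrArg φ h).trans ((he y).trans (congrArg ψ h).symm)
      · exact (congrArg φ h).trans ((hs j a b).trans (congrArg ψ h).symm)
      · exact (congrArg φ h).trans ((ht j b a).trans (congrArg ψ h).symm)
    | mul x y hx hy => rw [map_mul, map_mul, map_mul, hx, hy]
    | add x y hx hy => rw [map_add, map_add, map_add, hx, hy]

end Model

end BergmanPresentation

/-! ### Homomorphisms to and between matrix algebras -/

section Sandwich

variable {K : Type w} [Field K] {A : Type z} [Ring A] [Algebra K A] {ι : Type u} [Fintype ι]
  [DecidableEq ι]

/-- The homomorphism `b ↦ (v p * b * u q)` to the matrices, for `∑ p, u p * v p = 1`. -/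
def sandwichHom (u v : ι → A) (huv : ∑ p, u p * v p = 1) : A →ₙₐ[K] Matrix ι ι A where
  toFun b := Matrix.of fun p q => v p * b * u q
  map_smul' k b := by
    ext p q
    simp
  map_zero' := by
    ext p q
    simp
  map_add' b b' := by
    ext p q
    simp [mul_add, add_mul]
  map_mul' b b' := by
    ext p q
    have h : ∀ x, v p * b * u x * (v x * b' * u q) = v p * b * (u x * v x) * (b' * u q) :=
      fun x => by simp only [mul_assoc]
    simp_rw [Matrix.mul_apply, Matrix.of_apply, h, ← Finset.sum_mul, ← Finset.mul_sum, huv,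
      mul_one, mul_assoc]

/-- The homomorphism between matrix algebras that applies `Φ` to all entries. -/
def NonUnitalAlgHom.mapMat {B : Type*} [Ring B] [Algebra K B] (Φ : A →ₙₐ[K] B) :
    Matrix ι ι A →ₙₐ[K] Matrix ι ι B where
  toFun m := m.map Φ
  map_smul' k b := by
    ext p q
    simp
  map_zero' := by
    ext p q
    simp
  map_add' b b' := by
    ext p q
    simp
  map_mul' b b' := by
    ext p q
    simp [Matrix.mul_apply]

end Sandwich

/-! ### Split families and the transport between copies of a generator -/

namespace RelFamily

variable {X : Type u} {I : Type v}

/-- The family obtained from `D` by adjoining `n` copies of the generator `x₁` and of the relation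
`i`, and replacing the summands of the right-hand sides as prescribed by `β'`. -/
def split (D : RelFamily.{u, v, y} X I) (i : I) (n : ℕ) (β' : ∀ j, D.B j → X ⊕ Fin n) :
    RelFamily.{u, v, y} (X ⊕ Fin n) (I ⊕ Fin n) where
  A j := D.A (Sum.elim id (fun _ => i) j)
  B j := D.B (Sum.elim id (fun _ => i) j)
  α := Sum.rec (fun j a => Sum.inl (D.α j a)) fun q _ => Sum.inr q
  β _ b := β' _ b

/-- The generator of which a generator of the split family is a copy. -/
abbrev origin {n : ℕ} (x₁ : X) : X ⊕ Fin n → X := Sum.elim id fun _ => x₁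

namespace Split

variable {D : RelFamily.{u, v, y} X I} {i : I} {n : ℕ} {β' : ∀ j, D.B j → X ⊕ Fin n}
  {B : Type z} [Ring B] (ρ : (D.split i n β').Rep B) (a₀ : D.A i)

/-- The isomorphism from the module of `origin y` to that of `y`. -/
def toCopy : X ⊕ Fin n → B
  | Sum.inl x => ρ.e (Sum.inl x)
  | Sum.inr q => ∑ b : D.B i, ρ.s (Sum.inr q) a₀ b * ρ.t (Sum.inl i) b a₀

/-- The isomorphism from the module of `y` to that of `origin y`. -/
def ofCopy : X ⊕ Fin n → B
  | Sum.inl x => ρ.e (Sum.inl x)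
  | Sum.inr q => ∑ b : D.B i, ρ.s (Sum.inl i) a₀ b * ρ.t (Sum.inr q) b a₀

variable {x₁ : X}

theorem e_mul_toCopy (y : X ⊕ Fin n) : ρ.e y * toCopy ρ a₀ y = toCopy ρ a₀ y := by
  cases y with
  | inl x => exact ρ.idem _
  | inr q =>
    simp only [toCopy]
    rw [Finset.mul_sum]
    exact Finset.sum_congr rfl fun b _ => by
      rw [← mul_assoc]
      exact congrArg (· * _) (ρ.e_s (Sum.inr q) a₀ b)

theorem toCopy_mul_e (hx₁ : D.α i a₀ = x₁) (y : X ⊕ Fin n) :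
    toCopy ρ a₀ y * ρ.e (Sum.inl (origin x₁ y)) = toCopy ρ a₀ y := by
  subst hx₁
  cases y with
  | inl x => exact ρ.idem _
  | inr q =>
    simp only [toCopy]
    rw [Finset.sum_mul]
    exact Finset.sum_congr rfl fun b _ => by
      rw [mul_assoc]
      exact congrArg (_ * ·) (ρ.t_e (Sum.inl i) b a₀)

theorem e_mul_ofCopy (hx₁ : D.α i a₀ = x₁) (y : X ⊕ Fin n) :
    ρ.e (Sum.inl (origin x₁ y)) * ofCopy ρ a₀ y = ofCopy ρ a₀ y := by
  subst hx₁
  cases y with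
  | inl x => exact ρ.idem _
  | inr q =>
    simp only [ofCopy]
    rw [Finset.mul_sum]
    exact Finset.sum_congr rfl fun b _ => by
      rw [← mul_assoc]
      exact congrArg (· * _) (ρ.e_s (Sum.inl i) a₀ b)

theorem ofCopy_mul_e (y : X ⊕ Fin n) : ofCopy ρ a₀ y * ρ.e y = ofCopy ρ a₀ y := by
  cases y with
  | inl x => exact ρ.idem _
  | inr q =>
    simp only [ofCopy]
    rw [Finset.sum_mul]
    exact Finset.sum_congr rfl fun b _ => by
      rw [mul_assoc]
      exact congrArg (_ * ·) (ρ.t_e (Sum.inr q) b a₀)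

-- Contraction over the common right-hand side: `t'` and `s'` cancel to `e`, which `s` absorbs. With
-- `s` from one copy of relation `i` and `s'`, `t'` from another, this passes from one copy to the
-- other.
open Classical in
theorem sum_mul_mul_eq {γ : Type*} [Fintype γ] {e s s' t' : γ → B}
    (h : ∀ b b', t' b * s' b' = if b = b' then e b else 0) (hs : ∀ b, s b * e b = s b) (b : γ) :
    (∑ b', s b' * t' b') * s' b = s b := by
  simp_rw [Finset.sum_mul, mul_assoc, h]
  simp [hs]

open Classical in
theorem mul_sum_mul_eq {γ : Type*} [Fintype γ] {e s t t' : γ → B}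
    (h : ∀ b b', t b * s b' = if b = b' then e b else 0) (ht : ∀ b, e b * t' b = t' b) (b : γ) :
    t b * ∑ b', s b' * t' b' = t' b := by
  simp_rw [Finset.mul_sum, ← mul_assoc, h]
  simp [ht]

open Classical in
theorem t_mul_s_inl (hA : ∀ a, a = a₀) (b b' : D.B i) :
    ρ.t (Sum.inl i) b a₀ * ρ.s (Sum.inl i) a₀ b' =
    if b = b' then ρ.e (β' i b) else 0 := by
  rw [← Fintype.sum_eq_single (f := fun a => ρ.t (Sum.inl i) b a * ρ.s (Sum.inl i) a b') a₀
    fun a ha => absurd (hA a) ha]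
  exact ρ.t_s (Sum.inl i) b b'

open Classical in
theorem t_mul_s_inr (hA : ∀ a, a = a₀) (q : Fin n) (b b' : D.B i) :
    ρ.t (Sum.inr q) b a₀ * ρ.s (Sum.inr q) a₀ b' = if b = b' then ρ.e (β' i b) else 0 := by
  rw [← Fintype.sum_eq_single (f := fun a => ρ.t (Sum.inr q) b a * ρ.s (Sum.inr q) a b') a₀
    fun a ha => absurd (hA a) ha]
  exact ρ.t_s (Sum.inr q) b b'

/-- For a copy of relation `i`, the factor `ρ.t (Sum.inr q)` of `ofCopy` cancels `ρ.s (Sum.inr q)`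
and leaves the matrix of relation `i` itself. Together with `t_mul_toCopy` this computes the
sandwich of the generators of the split algebra. -/
theorem ofCopy_mul_s (hA : ∀ a, a = a₀) (j : I ⊕ Fin n)
    (a : (D.split i n β').A j) (b : (D.split i n β').B j) :
    ofCopy ρ a₀ ((D.split i n β').α j a) * ρ.s j a b =
      ρ.s (Sum.inl (Sum.elim id (fun _ => i) j)) a b := by
  cases j with
  | inl j => exact ρ.e_s (Sum.inl j) a b
  | inr q =>
    obtain rfl := hA a
    exact sum_mul_mul_eq (t_mul_s_inr ρ _ hA q) (fun b => ρ.s_e (Sum.inl i) _ b) b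

theorem t_mul_toCopy (hA : ∀ a, a = a₀) (j : I ⊕ Fin n)
    (a : (D.split i n β').A j) (b : (D.split i n β').B j) :
    ρ.t j b a * toCopy ρ a₀ ((D.split i n β').α j a) =
      ρ.t (Sum.inl (Sum.elim id (fun _ => i) j)) b a := by
  cases j with
  | inl j => exact ρ.t_e (Sum.inl j) b a
  | inr q =>
    obtain rfl := hA a
    exact mul_sum_mul_eq (t_mul_s_inr ρ _ hA q) (fun b => ρ.e_t (Sum.inl i) b _) b

theorem toCopy_mul_ofCopy (hA : ∀ a, a = a₀) (y : X ⊕ Fin n) :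
    toCopy ρ a₀ y * ofCopy ρ a₀ y = ρ.e y := by
  classical
  cases y with
  | inl x => exact ρ.idem _
  | inr q =>
    have h : ∑ b, ρ.s (Sum.inr q) a₀ b * ρ.t (Sum.inr q) b a₀ = ρ.e (Sum.inr q) :=
      (ρ.s_t (Sum.inr q) a₀ a₀).trans (if_pos rfl)
    rw [← h]
    simp only [ofCopy, Finset.mul_sum, ← mul_assoc]
    exact Finset.sum_congr rfl fun b _ => congrArg (· * _)
      (sum_mul_mul_eq (t_mul_s_inl ρ _ hA) (fun b => ρ.s_e (Sum.inr q) _ b) b)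

theorem ofCopy_mul_toCopy (hA : ∀ a, a = a₀) (hx₁ : D.α i a₀ = x₁) (y : X ⊕ Fin n) :
    ofCopy ρ a₀ y * toCopy ρ a₀ y = ρ.e (Sum.inl (origin x₁ y)) := by
  classical
  subst hx₁
  cases y with
  | inl x => exact ρ.idem _
  | inr q =>
    have h : ∑ b, ρ.s (Sum.inl i) a₀ b * ρ.t (Sum.inl i) b a₀ = ρ.e (Sum.inl (D.α i a₀)) :=
      (ρ.s_t (Sum.inl i) a₀ a₀).trans (if_pos rfl)
    refine Eq.trans ?_ h
    simp only [toCopy, Finset.mul_sum, ← mul_assoc]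
    exact Finset.sum_congr rfl fun b _ => congrArg (· * _)
      (sum_mul_mul_eq (t_mul_s_inr ρ _ hA q) (fun b => ρ.s_e (Sum.inl i) _ b) b)

variable (hA : ∀ a, a = a₀) (hx₁ : D.α i a₀ = x₁) (hβ : ∀ j b, origin x₁ (β' j b) = D.β j b)

/-- The representation of the original family that underlies one of the split family. -/
def restrict : D.Rep B where
  e x := ρ.e (Sum.inl x)
  -- A summand that was relabelled as a copy is transported back to the generator it comes from.
  s j a b := ρ.s (Sum.inl j) a b * toCopy ρ a₀ (β' j b)
  t j b a := ofCopy ρ a₀ (β' j b) * ρ.t (Sum.inl j) b a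
  idem x := ρ.idem _
  orth x x' h := ρ.orth _ _ (Sum.inl_injective.ne h)
  e_s j a b := by
    rw [← mul_assoc]
    exact congrArg (· * _) (ρ.e_s (Sum.inl j) a b)
  s_e j a b := by rw [← hβ, mul_assoc, toCopy_mul_e ρ a₀ hx₁]
  e_t j b a := by rw [← hβ, ← mul_assoc, e_mul_ofCopy ρ a₀ hx₁]
  t_e j b a := by
    rw [mul_assoc]
    exact congrArg (_ * ·) (ρ.t_e (Sum.inl j) b a)
  s_t j a a' := by
    have h := ρ.s_t (Sum.inl j) a a'
    refine Eq.trans (Finset.sum_congr rfl fun b _ => ?_) h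
    rw [mul_assoc, ← mul_assoc (toCopy _ _ _), toCopy_mul_ofCopy ρ a₀ hA, ← mul_assoc]
    exact congrArg (· * _) (ρ.s_e (Sum.inl j) a b)
  t_s j b b' := by
    classical
    have h := ρ.t_s (Sum.inl j) b b'
    calc ∑ a, ofCopy ρ a₀ (β' j b) * ρ.t (Sum.inl j) b a *
          (ρ.s (Sum.inl j) a b' * toCopy ρ a₀ (β' j b'))
        = ofCopy ρ a₀ (β' j b) * (∑ a, ρ.t (Sum.inl j) b a * ρ.s (Sum.inl j) a b') *
          toCopy ρ a₀ (β' j b') := by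
          simp only [Finset.mul_sum, Finset.sum_mul, mul_assoc]
      _ = ofCopy ρ a₀ (β' j b) * (if b = b' then ρ.e (β' j b) else 0) *
          toCopy ρ a₀ (β' j b') := by
          refine congrArg (fun x => ofCopy ρ a₀ (β' j b) * x * toCopy ρ a₀ (β' j b')) (h.trans ?_)
          congr
      _ = _ := by
          by_cases hb : b = b'
          · subst hb
            rw [if_pos rfl, if_pos rfl, ofCopy_mul_e, ofCopy_mul_toCopy ρ a₀ hA hx₁, hβ]
          · rw [if_neg hb, if_neg hb, mul_zero, zero_mul]

end Split

namespace Rep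

variable {D : RelFamily.{u, v, y} X I} {i : I} {n : ℕ} {β' : ∀ j, D.B j → X ⊕ Fin n}
  {A : Type z} [Ring A] (ρ : D.Rep A) {x₁ : X} [Fintype X] [DecidableEq X]

/-- The representation of the split family by matrices over a ring in which the original family is
represented. -/
def split (hα : ∀ a, D.α i a = x₁) (hβ : ∀ j b, origin x₁ (β' j b) = D.β j b) :
    (D.split i n β').Rep (Matrix (X ⊕ Fin n) (X ⊕ Fin n) A) :=
  have hα' : ∀ j a, origin x₁ ((D.split i n β').α j a) = D.α (Sum.elim id (fun _ => i) j) a :=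
    fun j a => match j with
      | Sum.inl j => rfl
      | Sum.inr q => (hα a).symm
  -- All copies carry the same idempotent `ρ.e x₁`; their different diagonal positions make them
  -- orthogonal.
  { e := fun y => Matrix.single y y (ρ.e (origin x₁ y))
    s := fun j a b => Matrix.single ((D.split i n β').α j a) ((D.split i n β').β j b)
      (ρ.s (Sum.elim id (fun _ => i) j) a b)
    t := fun j b a => Matrix.single ((D.split i n β').β j b) ((D.split i n β').α j a)
      (ρ.t (Sum.elim id (fun _ => i) j) b a)
    idem := fun y => by rw [Matrix.single_mul_single_same, ρ.idem]
    orth := fun y y' h => Matrix.single_mul_single_of_ne _ _ _ _ h _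
    e_s := fun j a b => by
      rw [Matrix.single_mul_single_same, hα']
      exact congrArg _ (ρ.e_s _ a b)
    s_e := fun j a b => by
      rw [Matrix.single_mul_single_same]
      exact congrArg _ ((congrArg (_ * ρ.e ·) (hβ _ b)).trans (ρ.s_e _ a b))
    e_t := fun j b a => by
      rw [Matrix.single_mul_single_same]
      exact congrArg _ ((congrArg (ρ.e · * _) (hβ _ b)).trans (ρ.e_t _ b a))
    t_e := fun j b a => by
      rw [Matrix.single_mul_single_same, hα']
      exact congrArg _ (ρ.t_e _ b a)
    s_t := fun j a a' => by
      classical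
      simp_rw [Matrix.single_mul_single_same]
      let f : A →+ Matrix (X ⊕ Fin n) (X ⊕ Fin n) A :=
        Matrix.singleAddMonoidHom ((D.split i n β').α j a) ((D.split i n β').α j a')
      refine (map_sum f _ _).symm.trans ?_
      by_cases h : a = a'
      · subst h
        refine (congrArg f ((ρ.s_t _ a a).trans (if_pos rfl))).trans ?_
        rw [if_pos rfl, hα']
        rfl
      · refine (congrArg f ((ρ.s_t _ a a').trans (if_neg h))).trans ?_
        rw [if_neg h, map_zero]
    t_s := fun j b b' => by
      classical
      simp_rw [Matrix.single_mul_single_same]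
      let f : A →+ Matrix (X ⊕ Fin n) (X ⊕ Fin n) A :=
        Matrix.singleAddMonoidHom ((D.split i n β').β j b) ((D.split i n β').β j b')
      refine (map_sum f _ _).symm.trans ?_
      by_cases h : b = b'
      · subst h
        refine (congrArg f ((ρ.t_s _ b b).trans (if_pos rfl))).trans ?_
        rw [if_pos rfl]
        exact congrArg f (congrArg ρ.e (hβ _ b).symm)
      · refine (congrArg f ((ρ.t_s _ b b').trans (if_neg h))).trans ?_
        rw [if_neg h, map_zero] }

end Rep

end RelFamily

/-! ### Morita equivalence for a split family -/

namespace RelFamily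

variable {X : Type u} {I : Type v}

theorem mapMat_single {K : Type w} [Field K] {A B : Type*} [Ring A] [Algebra K A] [Ring B]
    [Algebra K B] {ι : Type*} [Fintype ι] [DecidableEq ι] (Φ : A →ₙₐ[K] B) (p q : ι) (a : A) :
    Φ.mapMat (Matrix.single p q a) = Matrix.single p q (Φ a) := by
  ext p' q'
  change Φ (Matrix.single p q a p' q') = _
  rw [Matrix.single_apply, Matrix.single_apply, apply_ite Φ, map_zero]

/-- If `v p` and `u p` are multiples of orthogonal idempotents `e p`, and `x` lies in the corner of
`e y` and `e y'`, then the matrix `(v p * x * u q)` has at most one nonzero entry. -/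
theorem sandwichHom_eq_single {K : Type w} [Field K] {B : Type*} [Ring B] [Algebra K B]
    {ι : Type*} [Fintype ι] [DecidableEq ι] {e u v : ι → B} (huv : ∑ p, u p * v p = 1)
    (orth : ∀ y y', y ≠ y' → e y * e y' = 0) (hv : ∀ y, v y * e y = v y)
    (hu : ∀ y, e y * u y = u y) {x : B} {y y' : ι} (hx : e y * x = x) (hx' : x * e y' = x) :
    sandwichHom (K := K) u v huv x = Matrix.single y y' (v y * x * u y') := by
  ext p q
  change v p * x * u q = _
  rw [Matrix.single_apply]
  split_ifs with h
  · rw [h.1, h.2]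
  · rw [not_and_or] at h
    rcases h with h | h
    · rw [← hx, ← hv p, mul_assoc (v p), ← mul_assoc (e p), orth _ _ (Ne.symm h), zero_mul,
        mul_zero, zero_mul]
    · rw [← hx', ← hu q, mul_assoc (v p), mul_assoc x, ← mul_assoc (e y'), orth _ _ h, zero_mul,
        mul_zero, mul_zero]

-- The criterion is applied with the transport elements as `u` and `v`. Universality reduces both
-- sandwich identities to the generators `e`, `s` and `t`.
open Split in
theorem isMoritaEquivalent_split {K : Type w} [Field K] [Fintype X] {D : RelFamily.{u, v, y} X I}
    {i : I} {n : ℕ} {β' : ∀ j, D.B j → X ⊕ Fin n} {A B : Type (max u z)} [Ring A] [Ring B]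
    [Algebra K A] [Algebra K B] {ρ : D.Rep A} (hρ : ρ.IsUniversal K)
    {ρ' : (D.split i n β').Rep B} (hρ' : ρ'.IsUniversal K) {x₁ : X} {a₀ : D.A i}
    (hA : ∀ a, a = a₀) (hx₁ : D.α i a₀ = x₁) (hβ : ∀ j b, origin x₁ (β' j b) = D.β j b) :
    IsMoritaEquivalent K B A := by
  classical
  obtain ⟨Φ, hΦ⟩ := hρ.lift B (restrict ρ' a₀ hA hx₁ hβ)
  obtain ⟨Ψ, hΨ⟩ := hρ'.lift (Matrix (X ⊕ Fin n) (X ⊕ Fin n) A)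
    (ρ.split (fun a => (congrArg _ (hA a)).trans hx₁) hβ)
  have huv : ∑ p, toCopy ρ' a₀ p * ofCopy ρ' a₀ p = 1 := by
    simp_rw [toCopy_mul_ofCopy ρ' a₀ hA, hρ'.sum_e]
  -- This is both `r` and `c` of the criterion. It vanishes at the new generators because `Φ 1` is
  -- the sum of the old idempotents only.
  let r : X ⊕ Fin n → A := Sum.elim ρ.e 0
  have hcr : ∑ p, r p * r p = 1 := by
    simp [r, Fintype.sum_sum_type, ρ.idem, hρ.sum_e]
  have hΦe : ∀ x, Φ (ρ.e x) = ρ'.e (Sum.inl x) := hΦ.e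
  have hΦs : ∀ j a b, Φ (ρ.s j a b) = ρ'.s (Sum.inl j) a b * toCopy ρ' a₀ (β' j b) := hΦ.s
  have hΦt : ∀ j b a, Φ (ρ.t j b a) = ofCopy ρ' a₀ (β' j b) * ρ'.t (Sum.inl j) b a := hΦ.t
  have hΨe : ∀ y, Ψ (ρ'.e y) = Matrix.single y y (ρ.e (origin x₁ y)) := hΨ.e
  have hΨs : ∀ j a b, Ψ (ρ'.s j a b) = Matrix.single ((D.split i n β').α j a)
    ((D.split i n β').β j b) (ρ.s (Sum.elim id (fun _ => i) j) a b) := hΨ.s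
  have hΨt : ∀ j b a, Ψ (ρ'.t j b a) = Matrix.single ((D.split i n β').β j b)
    ((D.split i n β').α j a) (ρ.t (Sum.elim id (fun _ => i) j) b a) := hΨ.t
  have hΦ1 : Φ 1 = ∑ x, ρ'.e (Sum.inl x) := by
    rw [← hρ.sum_e, map_sum]
    exact Finset.sum_congr rfl fun x _ => hΦe x
  -- On each generator both sides are matrices with a single possibly nonzero entry, at the same
  -- position.
  have hmap : (Φ.mapMat).comp Ψ = sandwichHom (toCopy ρ' a₀) (ofCopy ρ' a₀) huv := by
    refine hρ'.ext _ _ _ (fun y => ?_) (fun j a b => ?_) fun j b a => ?_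
    · rw [sandwichHom_eq_single huv ρ'.orth (ofCopy_mul_e ρ' a₀) (e_mul_toCopy ρ' a₀)
        (ρ'.idem y) (ρ'.idem y), ofCopy_mul_e, ofCopy_mul_toCopy ρ' a₀ hA hx₁]
      change Φ.mapMat (Ψ _) = _
      rw [hΨe, mapMat_single, hΦe]
    · rw [sandwichHom_eq_single huv ρ'.orth (ofCopy_mul_e ρ' a₀) (e_mul_toCopy ρ' a₀)
        (ρ'.e_s j a b) (ρ'.s_e j a b), ofCopy_mul_s ρ' a₀ hA]
      change Φ.mapMat (Ψ _) = _
      rw [hΨs, mapMat_single]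
      exact congrArg _ (hΦs _ a b)
    · rw [sandwichHom_eq_single huv ρ'.orth (ofCopy_mul_e ρ' a₀) (e_mul_toCopy ρ' a₀)
        (ρ'.e_t j b a) (ρ'.t_e j b a), mul_assoc, t_mul_toCopy ρ' a₀ hA]
      change Φ.mapMat (Ψ _) = _
      rw [hΨt, mapMat_single]
      exact congrArg _ (hΦt _ b a)
  -- The positions `p` and `q` are left free so that the same computation gives the images under `Ψ`
  -- of `ofCopy` and of `toCopy`.
  have hst : ∀ p q : X ⊕ Fin n, ∑ b, Matrix.single p (β' i b) (ρ.s i a₀ b) *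
      Matrix.single (β' i b) q (ρ.t i b a₀) = Matrix.single p q (ρ.e x₁) := fun p q => by
    simp_rw [Matrix.single_mul_single_same]
    let f : A →+ Matrix (X ⊕ Fin n) (X ⊕ Fin n) A := Matrix.singleAddMonoidHom p q
    refine (map_sum f _ _).symm.trans (congrArg f ?_)
    rw [ρ.s_t, if_pos rfl, hx₁]
  have hΨV : ∀ y, Ψ (ofCopy ρ' a₀ y) =
      Matrix.single (Sum.inl (origin x₁ y)) y (ρ.e (origin x₁ y)) := by
    rintro (x | q)
    · exact hΨe _
    · refine Eq.trans ?_ (hst _ _)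
      simp only [ofCopy, map_sum, map_mul]
      refine Finset.sum_congr rfl fun b _ => ?_
      subst hx₁
      exact congrArg₂ (· * ·) (hΨs (Sum.inl i) a₀ b) (hΨt (Sum.inr q) b a₀)
  have hΨU : ∀ y, Ψ (toCopy ρ' a₀ y) =
      Matrix.single y (Sum.inl (origin x₁ y)) (ρ.e (origin x₁ y)) := by
    rintro (x | q)
    · exact hΨe _
    · refine Eq.trans ?_ (hst _ _)
      simp only [toCopy, map_sum, map_mul]
      refine Finset.sum_congr rfl fun b _ => ?_
      subst hx₁
      exact congrArg₂ (· * ·) (hΨs (Sum.inr q) a₀ b) (hΨt (Sum.inl i) b a₀)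
  have horth : ∀ y y', y ≠ y' → r y * r y' = 0 := by
    rintro (x | q) (x' | q') h
    · exact ρ.orth x x' fun hx => h (congrArg _ hx)
    · exact mul_zero _
    · exact zero_mul _
    · exact zero_mul _
  have hidem : ∀ y, r y * r y = r y := by
    rintro (x | q)
    · exact ρ.idem x
    · exact zero_mul _
  have hr : ∀ {x x' : X} {c : A}, ρ.e x * c = c → c * ρ.e x' = c →
      sandwichHom (K := K) r r hcr c = Matrix.single (Sum.inl x) (Sum.inl x') c := by
    intro x x' c h h'
    rw [sandwichHom_eq_single (y := Sum.inl x) (y' := Sum.inl x') hcr horth hidem hidem h h']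
    exact congrArg _ ((congrArg (· * _) h).trans h')
  have hcomp : Ψ.comp Φ = sandwichHom r r hcr := by
    refine hρ.ext _ _ _ (fun x => ?_) (fun j a b => ?_) fun j b a => ?_
    · rw [hr (ρ.idem x) (ρ.idem x)]
      exact (congrArg Ψ (hΦe x)).trans (hΨe _)
    · rw [hr (ρ.e_s j a b) (ρ.s_e j a b)]
      refine (congrArg Ψ (hΦs j a b)).trans ?_
      rw [map_mul, hΨU]
      refine (congrArg (· * _) (hΨs (Sum.inl j) a b)).trans ?_
      refine (Matrix.single_mul_single_same _ _ _ _ _).trans ?_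
      rw [hβ]
      exact congrArg _ (ρ.s_e j a b)
    · rw [hr (ρ.e_t j b a) (ρ.t_e j b a)]
      refine (congrArg Ψ (hΦt j b a)).trans ?_
      rw [map_mul, hΨV]
      refine (congrArg (_ * ·) (hΨt (Sum.inl j) b a)).trans ?_
      refine (Matrix.single_mul_single_same _ _ _ _ _).trans ?_
      rw [hβ]
      exact congrArg _ (ρ.e_t j b a)
  refine .of_nonUnitalAlgHom Φ Ψ (toCopy ρ' a₀) (ofCopy ρ' a₀) r r huv hcr (fun p => ?_)
    (fun b p q => congrFun (congrFun (DFunLike.congr_fun hmap b) p) q)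
    fun a p q => congrFun (congrFun (DFunLike.congr_fun hcomp a) p) q
  rw [hΦ1, Finset.mul_sum]
  cases p with
  | inl x =>
    rw [Finset.sum_eq_single x, ofCopy_mul_e]
    · exact (hΦe x).symm
    · intro x' _ h
      exact ρ'.orth _ _ (Sum.inl_injective.ne h.symm)
    · simp
  | inr q =>
    -- At a new generator `ofCopy` ends in the new idempotent, which is orthogonal to all old ones.
    refine (Finset.sum_eq_zero fun x _ => ?_).trans (map_zero Φ).symm
    rw [← ofCopy_mul_e, mul_assoc, ρ'.orth _ _ Sum.inr_ne_inl, mul_zero]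

end RelFamily

/-! ### Insplitting of presentations as splitting of indexed families -/

namespace BergmanPresentation

variable {X : Type u} {I : Type v}

open Classical in
/-- The occurrences of generators in a sum over a finite index set are the indices. -/
theorem exists_occ_equiv {F : Type*} [Fintype F] (f : F → X) {c : Multiset X}
    (hc : c = Finset.univ.val.map f) : ∃ e : Occ c ≃ F, ∀ o, f (e o) = o.1 := by
  have h : ∀ x, Nonempty (Fin (c.count x) ≃ {a // f a = x}) := fun x => by
    refine ⟨Fintype.equivOfCardEq ?_⟩
    rw [Fintype.card_fin, hc, Multiset.count_map, Fintype.card_subtype]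
    simp only [eq_comm]
    rfl
  let g := fun x => (h x).some
  refine ⟨(Equiv.sigmaCongrRight g).trans (Equiv.sigmaFiberEquiv f), fun o => ?_⟩
  exact (g o.1 o.2).2

open Classical in
/-- The relations of a presentation, whose sides are indexed by the occurrences of generators. -/
noncomputable def family (P : BergmanPresentation X I) : RelFamily X I :=
  haveI := P.finite_generators
  { A := fun i => Occ (P.a i)
    B := fun i => Occ (P.b i)
    fintypeA := fun _ => Fintype.ofFinite _
    fintypeB := fun _ => Fintype.ofFinite _
    α := fun _ o => o.1
    β := fun _ o => o.1 }

open Classical in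
theorem map_fst_occ (c : Multiset X) [Fintype (Occ c)] :
    (Finset.univ : Finset (Occ c)).val.map Sigma.fst = c := by
  have h : @Multiset.fintypeCoe X _ c = ‹Fintype (Occ c)› := Subsingleton.elim _ _
  rw [← h]
  exact Multiset.map_univ_coe c

variable {P : BergmanPresentation X I}

/-- For a basic presentation, the matrix `ε_c` has one row for each occurrence of a generator. -/
def IsBasic.idxEquiv (hP : P.IsBasic) (c : Multiset X) : P.Idx c ≃ Occ c where
  toFun q := q.1
  invFun o := ⟨o, Slot.base _ (hP _)⟩
  left_inv q := by
    obtain ⟨o, q⟩ := q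
    rw [hP.slot_eq q]
  right_inv _ := rfl

/-- The rows of `ε_c` are the occurrences in `c`, and these can be matched with any index set that
lists the summands of `c`. -/
theorem Model.nonempty_of_map {Y : Type*} {J : Type*} {D : RelFamily Y J} (hP : P.IsBasic)
    (eX : Y ≃ X) (eI : J ≃ I) (hA : ∀ j, P.a (eI j) = Finset.univ.val.map fun a => eX (D.α j a))
    (hB : ∀ j, P.b (eI j) = Finset.univ.val.map fun b => eX (D.β j b)) : Nonempty (P.Model D) := by
  choose fA hfA using fun j => exists_occ_equiv _ (hA j)
  choose fB hfB using fun j => exists_occ_equiv _ (hB j)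
  exact ⟨{
    basic := hP
    eX := eX
    eI := eI
    idxA := fun {i j} h => (hP.idxEquiv (P.a i)).trans (h ▸ fA j)
    idxB := fun {i j} h => (hP.idxEquiv (P.b i)).trans (h ▸ fB j)
    idxA_spec := fun {i j} h q => by
      subst h
      exact hfA j _
    idxB_spec := fun {i j} h q => by
      subst h
      exact hfB j _ }⟩

theorem nonempty_model_family (hP : P.IsBasic) : Nonempty (P.Model P.family) :=
  Model.nonempty_of_map hP (Equiv.refl X) (Equiv.refl I)
    (fun i => (@map_fst_occ _ (P.a i) (P.family.fintypeA i)).symm)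
    (fun i => (@map_fst_occ _ (P.b i) (P.family.fintypeB i)).symm)

-- The new right-hand side is still indexed by the occurrences in the old one; only the labels
-- change. This is why `RelFamily.split` can keep the index types of `D`.
open Classical in
theorem splitSum_eq_map {X' : Type u} {n : ℕ} (x₁ : X) (old : X → X') (gen : Fin n → X')
    (c : Multiset X) (φ : Fin (c.count x₁) → Fin n) [Fintype (Occ c)] :
    splitSum x₁ old gen c φ = (Finset.univ : Finset (Occ c)).val.map fun o =>
      if h : o.1 = x₁ then gen (φ (h ▸ o.2)) else old o.1 := by
  have hX : (c.filter fun x => x ≠ x₁).map old =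
      ∑ o : Occ c, if o.1 ≠ x₁ then {old o.1} else 0 := by
    conv_lhs => rw [← map_fst_occ c, Multiset.filter_map, Multiset.map_map]
    rw [← Finset.sum_filter]
    refine (Multiset.sum_map_singleton _).symm.trans ?_
    rw [Multiset.map_map]
    rfl
  have hG : ∑ k : Fin (c.count x₁), ({gen (φ k)} : Multiset X') =
      ∑ o : Occ c, if h : o.1 = x₁ then {gen (φ (h ▸ o.2))} else 0 := by
    let f : Occ c → Multiset X' := fun o => if h : o.1 = x₁ then {gen (φ (h ▸ o.2))} else 0
    -- The sum over the occurrences of `x₁` is extended by zero to all occurrences.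
    have hf : ∀ o ∉ Finset.univ.map (Function.Embedding.sigmaMk (β := fun y => Fin (c.count y)) x₁),
        f o = 0 := by
      rintro ⟨x, k⟩ h
      refine dif_neg fun hx => h ?_
      obtain rfl : x = x₁ := hx
      exact Finset.mem_map_of_mem _ (Finset.mem_univ k)
    refine Eq.trans ?_ (Finset.sum_subset (Finset.subset_univ _) fun o _ => hf o)
    rw [Finset.sum_map]
    refine Finset.sum_congr rfl fun k _ => ?_
    exact (dif_pos (c := x₁ = x₁) (t := fun h => ({gen (φ (h ▸ k))} : Multiset X'))
      (e := fun _ => 0) rfl).symm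
  rw [splitSum, hX, hG, ← Finset.sum_add_distrib, ← Multiset.sum_map_singleton
    (Multiset.map _ _), Multiset.map_map]
  refine Finset.sum_congr rfl fun o _ => ?_
  simp only [Function.comp_apply]
  by_cases h : o.1 = x₁ <;> simp [h]

-- Graphs prescribe multiplicities where presentations list summands. The copies are distinct from
-- each other and from the other old generators, so multiplicities can be compared one generator at
-- a time.
open Classical in
theorem eq_splitSum {X' : Type u} {n : ℕ} {x₁ : X} (eX : X ⊕ Fin n ≃ X') {c : Multiset X}
    {c' : Multiset X'} {φ : Fin (c.count x₁) → Fin (n + 1)}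
    (hx : ∀ x, x ≠ x₁ → c'.count (eX (Sum.inl x)) = c.count x)
    (hq : ∀ q, c'.count ((Fin.cons (eX (Sum.inl x₁)) fun q => eX (Sum.inr q) :
      Fin (n + 1) → X') q) = Nat.card {k // φ k = q}) :
    c' = splitSum x₁ (fun x => eX (Sum.inl x))
      (Fin.cons (eX (Sum.inl x₁)) fun q => eX (Sum.inr q)) c φ := by
  set gen : Fin (n + 1) → X' := Fin.cons (eX (Sum.inl x₁)) fun q => eX (Sum.inr q) with hgen
  have hinj : Function.Injective gen := by
    rw [hgen, Fin.cons_injective_iff]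
    refine ⟨?_, eX.injective.comp Sum.inr_injective⟩
    rintro ⟨q, hq⟩
    exact Sum.inr_ne_inl (eX.injective hq)
  have hgen_ne : ∀ x, x ≠ x₁ → ∀ q, eX (Sum.inl x) ≠ gen q := by
    intro x hx q h
    cases q using Fin.cases with
    | zero => exact hx (Sum.inl_injective (eX.injective h))
    | succ q => exact Sum.inl_ne_inr (eX.injective h)
  have key : ∀ q, c'.count (gen q) =
      (splitSum x₁ (fun x => eX (Sum.inl x)) gen c φ).count (gen q) := by
    intro q
    have h0 : ((c.filter fun x => x ≠ x₁).map fun x => eX (Sum.inl x)).count (gen q) = 0 := by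
      refine Multiset.count_eq_zero.2 fun h => ?_
      obtain ⟨x, hxm, hxq⟩ := Multiset.mem_map.1 h
      exact hgen_ne x (Multiset.mem_filter.1 hxm).2 q hxq
    rw [hq, splitSum, Multiset.count_add, h0, zero_add, Multiset.count_sum']
    simp_rw [Multiset.count_singleton, hinj.eq_iff, Finset.sum_boole, Nat.card_eq_fintype_card,
      Fintype.card_subtype, eq_comm (a := q)]
    rfl
  refine Multiset.ext.2 fun x' => ?_
  obtain ⟨x | q, rfl⟩ := eX.surjective x'
  · by_cases h : x = x₁
    -- The old generator `x₁` is the copy with index 0.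
    · subst h
      exact key 0
    · rw [hx x h, splitSum, Multiset.count_add, Multiset.count_sum', Finset.sum_eq_zero, add_zero,
        Multiset.count_map_eq_count' (fun x => eX (Sum.inl x)) _
          (eX.injective.comp Sum.inl_injective),
        Multiset.count_filter_of_pos (p := fun x => x ≠ x₁) h]
      intro k _
      rw [Multiset.count_singleton, if_neg (hgen_ne x h _)]
  · exact key q.succ

theorem IsInsplitting.isMoritaEquivalent (K : Type w) [Field K] {X' : Type u} {I' : Type v}
    {P' : BergmanPresentation X' I'} (h : P.IsInsplitting P') :
    IsMoritaEquivalent K (P'.BergmanAlgebra K) (P.BergmanAlgebra K) := by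
  classical
  obtain ⟨hP, hP', x₁, i, n, φ, eX, eI, ha, -, -, hj, hp⟩ := h
  have := P.finite_generators
  let _ : Fintype X := Fintype.ofFinite X
  let g : Fin (n + 1) → X ⊕ Fin n := Fin.cons (Sum.inl x₁) Sum.inr
  let β' : ∀ j, P.family.B j → X ⊕ Fin n := fun j o =>
    if h : o.1 = x₁ then g (φ ⟨j, h ▸ o.2⟩) else Sum.inl o.1
  obtain ⟨M⟩ := nonempty_model_family hP
  have hgen : ∀ p, (Fin.cons (eX (Sum.inl x₁)) fun q => eX (Sum.inr q) : Fin (n + 1) → X') p =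
      eX (g p) := fun p => by
    cases p using Fin.cases <;> rfl
  have hb : ∀ j, splitSum x₁ (fun x => eX (Sum.inl x))
      (Fin.cons (eX (Sum.inl x₁)) fun q => eX (Sum.inr q)) (P.b j) (fun k => φ ⟨j, k⟩) =
      (Finset.univ.val.map fun b => eX (β' j b)) := fun j => by
    rw [@splitSum_eq_map _ _ _ _ _ _ _ _ (P.family.fintypeB j)]
    refine Multiset.map_congr rfl fun o _ => ?_
    rw [apply_dite eX]
    simp only [hgen]
  have ha' : ∀ {Z : Type _} (j : I) (f : X → Z),
      (P.a j).map f = Finset.univ.val.map fun a => f (P.family.α j a) := fun j f => by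
    conv_lhs => rw [← @map_fst_occ _ (P.a j) (P.family.fintypeA j), Multiset.map_map]
    rfl
  obtain ⟨M'⟩ : Nonempty (P'.Model (P.family.split i n β')) := by
    refine Model.nonempty_of_map hP' eX eI ?_ ?_
    · rintro (j | q)
      · refine Eq.trans ?_ (ha' j fun x => eX (Sum.inl x))
        -- The relation with the old index `i` is copy number 0, so it is described by `hp 0` and
        -- not by `hj`; the new index `q` is copy `q.succ`.
        by_cases hji : j = i
        · subst hji
          rw [ha]
          exact (hp 0).1
        · exact (hj j hji).1
      · refine Eq.trans ?_ (ha' i fun _ => eX (Sum.inr q))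
        rw [ha]
        exact (hp q.succ).1
    · rintro (j | q)
      · by_cases hji : j = i
        · subst hji
          exact (hp 0).2.trans (hb j)
        · exact (hj j hji).2.trans (hb j)
      · exact (hp q.succ).2.trans (hb i)
  have hOcc : ∀ o : P.family.A i, o.1 = x₁ := fun o => by
    have h : o.1 ∈ P.a i := Multiset.count_pos.mp (lt_of_le_of_lt (Nat.zero_le _) o.2.2)
    exact Multiset.mem_singleton.1 (ha ▸ h)
  have hcount : (P.a i).count x₁ = 1 := by rw [ha, Multiset.count_singleton_self]
  -- The only occurrence on the left-hand side of relation `i`.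
  let a₀ : P.family.A i := ⟨x₁, ⟨0, by rw [hcount]; exact one_pos⟩⟩
  refine RelFamily.isMoritaEquivalent_split.{u, v, w, _, max u v w} (M.rep_isUniversal K)
    (M'.rep_isUniversal K) (x₁ := x₁) (a₀ := a₀) ?_ rfl ?_
  · rintro ⟨x, k⟩
    obtain rfl : x = x₁ := hOcc ⟨x, k⟩
    have h : ∀ k k' : Fin ((P.a i).count x), k = k' := by
      rw [hcount]
      exact fun k k' => Subsingleton.elim k k'
    exact congrArg (Sigma.mk x) (h k _)
  · intro j o
    have hg : ∀ p, RelFamily.origin x₁ (g p) = x₁ := fun p => by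
      cases p using Fin.cases <;> rfl
    by_cases ho : o.1 = x₁
    · simp only [β', dif_pos ho, hg]
      exact ho.symm
    · simp only [β', dif_neg ho]
      rfl

end BergmanPresentation

/-! ### From graphs to presentations -/

theorem formalSum_single {V : Type u} [Finite V] [DecidableEq V] (v : V) :
    formalSum (Pi.single v 1) = {v} := by
  refine Multiset.ext.2 fun u => ?_
  classical
  rw [Multiset.count_singleton, ← Pi.single_apply]
  convert count_formalSum (Pi.single v 1) u

namespace BergmanGraph

variable {V : Type u} {E : Type v} {H : BergmanGraph V E}

theorem IsBasic.toPresentation (hH : H.IsBasic) : H.toPresentation.IsBasic := fun v h hh hv =>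
  hH v h hh ((@mem_formalSum _ H.finite_vertices _ _).1 hv)

/-- Multisets are determined by their multiplicities, which `formalSum` takes from the graph. The
partition `φ` is carried over along the equality of `H.r g v₁` with the multiplicity of `v₁` in the
right-hand side. -/
theorem IsInsplitting.toPresentation {V' : Type u} {E' : Type v} {H' : BergmanGraph V' E'}
    (h : H.IsInsplitting H') : H.toPresentation.IsInsplitting H'.toPresentation := by
  classical
  obtain ⟨hH, hH', v₁, h₁, n, φ, eV, eE, hs, hs', hφ, hg, hp⟩ := h
  have := H.finite_vertices
  have := H'.finite_vertices
  have hv : ∀ p, (Fin.cons (eV (Sum.inl v₁)) fun q => eV (Sum.inr q) : Fin (n + 1) → V') p =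
      eV ((Fin.cons (Sum.inl v₁) Sum.inr : Fin (n + 1) → V ⊕ Fin n) p) := fun p => by
    cases p using Fin.cases <;> rfl
  have hb : ∀ g, H.toPresentation.b g = formalSum (H.r g) := fun _ => rfl
  have hcount : ∀ g, (H.toPresentation.b g).count v₁ = H.r g v₁ := fun g =>
    count_formalSum (H.r g) v₁
  have hsplit : ∀ g g', (∀ u, u ≠ v₁ → H'.r g' (eV (Sum.inl u)) = H.r g u) →
      (∀ q, H'.r g' ((Fin.cons (eV (Sum.inl v₁)) fun q => eV (Sum.inr q) : Fin (n + 1) → V') q) =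
        Nat.card {k : Fin (H.r g v₁) // φ ⟨g, k⟩ = q}) →
      H'.toPresentation.b g' = BergmanPresentation.splitSum v₁ (fun u => eV (Sum.inl u))
        (Fin.cons (eV (Sum.inl v₁)) fun q => eV (Sum.inr q)) (H.toPresentation.b g)
        fun k => φ ⟨g, Fin.cast (hcount g) k⟩ := by
    intro g g' hu hq
    refine BergmanPresentation.eq_splitSum eV (fun u h => ?_) fun q => ?_
    · exact (count_formalSum _ _).trans ((hu u h).trans (count_formalSum _ _).symm)
    · refine (count_formalSum _ _).trans ((hq q).trans ?_)
      exact Nat.card_congr ((finCongr (hcount g)).subtypeEquiv fun k => Iff.rfl).symm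
  refine ⟨hH.toPresentation, hH'.toPresentation, v₁, h₁, n,
    fun k => φ ⟨k.1, Fin.cast (hcount k.1) k.2⟩, eV, eE, ?_, ?_, ?_, fun g h => ⟨?_, ?_⟩,
    fun p => ⟨?_, ?_⟩⟩
  · exact (congrArg formalSum hs).trans (formalSum_single v₁)
  · intro g h hmem
    exact (mem_formalSum _ _).1 hmem (hs' g h)
  · intro q
    obtain ⟨⟨g, k⟩, rfl⟩ := hφ q
    exact ⟨⟨g, Fin.cast (hcount g).symm k⟩, rfl⟩
  · obtain ⟨h1, h2, -, -⟩ := hg g h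
    refine Multiset.ext.2 fun v => ?_
    refine (count_formalSum _ _).trans ?_
    obtain ⟨u | q, rfl⟩ := eV.surjective v
    · refine (h1 u).trans ?_
      refine Eq.trans ?_ (Multiset.count_map_eq_count' _ _
        (eV.injective.comp Sum.inl_injective) _).symm
      exact (count_formalSum _ _).symm
    -- The new vertex `q` is copy `q.succ`, because copy 0 is `v₁`; the image of the old vertices
    -- misses it.
    · refine (h2 q.succ).trans (Multiset.count_eq_zero.2 fun hm => ?_).symm
      obtain ⟨u, -, hu⟩ := Multiset.mem_map.1 hm
      exact Sum.inl_ne_inr (eV.injective hu)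
  · exact hsplit g _ (hg g h).2.2.1 (hg g h).2.2.2
  · exact (congrArg formalSum (hp p).1).trans (formalSum_single _)
  · exact hsplit h₁ _ (hp p).2.1 (hp p).2.2

end BergmanGraph

theorem mainTheorem3 (K : Type w) [Field K] :
    (∀ (X X' : Type u) (I I' : Type v) (P : BergmanPresentation X I)
      (P' : BergmanPresentation X' I'), P.IsBasic → P.IsInsplitting P' →
        IsMoritaEquivalent K (P'.BergmanAlgebra K) (P.BergmanAlgebra K)) ∧
    (∀ (V V' : Type u) (E E' : Type v) (H : BergmanGraph V E) (H' : BergmanGraph V' E'),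
      H.IsBasic → H.IsInsplitting H' →
        IsMoritaEquivalent K (H'.BergmanAlgebra K) (H.BergmanAlgebra K)) :=
  ⟨fun _ _ _ _ _ _ _ h => h.isMoritaEquivalent K,
    fun _ _ _ _ _ _ _ h => h.toPresentation.isMoritaEquivalent K⟩
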